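/- Let $\mathscr M_+([0,\infty))$ be the set of finite positive Borel measures on $[0,\infty)$, with the narrow topology (convergence against bounded continuous functions), let $M_\alpha(\mu)=\int_{[0,\infty)}x^\alpha\,d\mu(x)$, and let $\mathscr M_+^1([0,\infty))=\{\mu\in\mathscr M_+([0,\infty)):M_1(\mu)<\infty\}$. Let $C^1_b([0,\infty))$ be the set of continuously differentiable functions on $[0,\infty)$ that are bounded together with their derivative. For $\varphi\in C^1_b([0,\infty))$ and $\mu\in\mathscr M^1_+([0,\infty))$ put $$\Lambda(\varphi)(x,y)=\varphi(x+y)+\varphi(|x-y|)-2\varphi(\max\{x,y\}),\qquad \mathcal L(\varphi)(x)=x\varphi(x)-2\int_0^x\varphi(y)\,dy,$$ $$\widetilde{\mathscr Q}_3(\varphi,\mu)=\iint_{(0,\infty)^2}\frac{\Lambda(\varphi)(x,y)}{\sqrt{xy}}\,d\mu(x)\,d\mu(y)-\int_{(0,\infty)}\frac{\mathcal L(\varphi)(x)}{\sqrt x}\,d\mu(x).$$ **Theorem.** Let $h\in C([0,\infty);\mathscr M_+^1([0,\infty)))$ (continuous for the narrow topology) be a weak solution of $$\frac{d}{d\tau}\int_{[0,\infty)}\varphi(x)\,dh(\tau)(x)=\widetilde{\mathscr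 Q}_3(\varphi,h(\tau))\qquad\forall\varphi\in C^1_b([0,\infty)),$$ meaning that for every $\varphi\in C_b^1([0,\infty))$ the function $\tau\mapsto\int_{[0,\infty)}\varphi\,dh(\tau)$ is locally absolutely continuous on $[0,\infty)$ (for instance locally Lipschitz) and the equation holds for a.e. $\tau>0$. Suppose that $h(0)=h_0\in\mathscr M_+^1([0,\infty))$ with $N=M_0(h_0)>0$ and $E=M_1(h_0)>0$. Then the function $m(\tau)=h(\tau)(\{0\})$ is right continuous, a.e. differentiable and strictly increasing on $[0,\infty)$. -/

import Mathlib

open MeasureTheory Set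
open scoped NNReal ENNReal

namespace BoseCondensate

noncomputable section

/-- The moment `M_α(μ) = ∫_{[0,∞)} x^α dμ(x)`, with values in `[0,∞]`. -/
def moment (α : ℝ) (μ : FiniteMeasure ℝ≥0) : ℝ≥0∞ :=
  ∫⁻ x : ℝ≥0, (x : ℝ≥0∞) ^ α ∂(μ : Measure ℝ≥0)

/-- `φ ∈ C¹_b([0,∞))`: `φ` is continuously differentiable on `[0,∞)` (one-sidedly at `0`),
and `φ` and `φ'` are bounded there. The values of `φ` on `(-∞,0)` play no role. -/
def IsC1b (φ : ℝ → ℝ) : Prop :=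
  ContDiffOn ℝ 1 φ (Ici 0) ∧
    (∃ C : ℝ, ∀ x ∈ Ici (0 : ℝ), |φ x| ≤ C) ∧
    (∃ C : ℝ, ∀ x ∈ Ici (0 : ℝ), |derivWithin φ (Ici 0) x| ≤ C)

/-- `Λ(φ)(x,y) = φ(x+y) + φ(|x-y|) - 2 φ(max{x,y})`. -/
def Lam (φ : ℝ → ℝ) (x y : ℝ) : ℝ :=
  φ (x + y) + φ |x - y| - 2 * φ (max x y)

/-- `L(φ)(x) = x φ(x) - 2 ∫₀ˣ φ(y) dy`. -/
def calL (φ : ℝ → ℝ) (x : ℝ) : ℝ :=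
  x * φ x - 2 * ∫ y in (0 : ℝ)..x, φ y

/-- The quadratic term `∬_{(0,∞)²} Λ(φ)(x,y) / √(xy) dμ(x) dμ(y)`. -/
def Q32 (φ : ℝ → ℝ) (μ : FiniteMeasure ℝ≥0) : ℝ :=
  ∫ p in (Ioi (0 : ℝ≥0)) ×ˢ (Ioi (0 : ℝ≥0)),
    Lam φ (p.1 : ℝ) (p.2 : ℝ) / Real.sqrt ((p.1 : ℝ) * (p.2 : ℝ))
      ∂((μ : Measure ℝ≥0).prod (μ : Measure ℝ≥0))

/-- The linear term `∫_{(0,∞)} L(φ)(x) / √x dμ(x)`. -/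
def Q31tilde (φ : ℝ → ℝ) (μ : FiniteMeasure ℝ≥0) : ℝ :=
  ∫ x in Ioi (0 : ℝ≥0), calL φ (x : ℝ) / Real.sqrt (x : ℝ) ∂(μ : Measure ℝ≥0)

/-- The full operator: quadratic term minus linear term. -/
def Q3tilde (φ : ℝ → ℝ) (μ : FiniteMeasure ℝ≥0) : ℝ :=
  Q32 φ μ - Q31tilde φ μ

/-- `h`, restricted to times `τ ≥ 0`, is a weak solution of
`d/dτ ∫ φ dh(τ) = Q3tilde φ (h τ)` for all `φ ∈ C¹_b([0,∞))`: the function `τ ↦ ∫ φ dh(τ)` is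
locally absolutely continuous on `[0,∞)` (in particular this allows all functions of class
`W^{1,∞}_loc([0,∞))`, i.e. locally Lipschitz ones) and the equation holds for a.e. `τ > 0`, with
an exceptional set that may depend on `φ`. -/
def IsWeakSolution (h : ℝ → FiniteMeasure ℝ≥0) : Prop :=
  ∀ φ : ℝ → ℝ, IsC1b φ →
    (∀ T : ℝ, 0 < T → AbsolutelyContinuousOnInterval
      (fun τ => ∫ x : ℝ≥0, φ (x : ℝ) ∂(h τ : Measure ℝ≥0)) 0 T) ∧
    ∀ᵐ τ ∂(volume.restrict (Ioi (0 : ℝ))),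
      HasDerivAt (fun s => ∫ x : ℝ≥0, φ (x : ℝ) ∂(h s : Measure ℝ≥0)) (Q3tilde φ (h τ)) τ

/-- `h ∈ C([0,∞); M₊¹([0,∞)))`: finite first moment at each time `τ ≥ 0`, and continuity on
`[0,∞)` for the narrow topology (the topology of `FiniteMeasure`). -/
def IsNarrowCurve (h : ℝ → FiniteMeasure ℝ≥0) : Prop :=
  ContinuousOn h (Ici 0) ∧ ∀ τ ∈ Ici (0 : ℝ), moment 1 (h τ) < ∞

/-- The mass `m(τ) = h(τ,{0})` of the atom at the origin. -/
def atomAtZero (h : ℝ → FiniteMeasure ℝ≥0) (τ : ℝ) : ℝ :=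
  (h τ : Measure ℝ≥0).real {0}

end

end BoseCondensate

namespace BoseCondensate

open Filter Topology

/-! The test functions `bump c`, x ↦ (1 - c x)₊², are convex, and on [0, ∞) they decrease to the
indicator of {0} as c → ∞. Convexity makes Λ nonnegative on them and L is nonpositive, so each ∫
bump c dh(τ) is nondecreasing in τ. Hence m is a decreasing limit of continuous nondecreasing
functions. This yields monotonicity, right continuity and, by Lebesgue's theorem, a.e.
differentiability.

Strictness is proved by contradiction. If m is constant on [a, b], let f_n = ∫ bump (2^n) dh - m, a
smoothed mass of (0, 2⁻ⁿ), and let J_k be the mass of the shell (2⁻ᵏ⁻¹, 2⁻ᵏ]. Two lower bounds hold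
for f_n': the quadratic term gives (1/4) 2⁻ⁿ ∑_{k ≤ n} (2^k J_k)² (`flux_le_Q32`), and the linear
term gives a source c₀ 2⁻ⁿ, fed by mass that never leaves (0, ∞) (`source_le_neg_Q31tilde`,
`IsWeakSolution.measure_Ioi_pos`).

The first bound forces 2^n f_n(s) ≤ C / (b - s), since a Riccati inequality would otherwise blow up
before b (`DyadicCascade.density_le`). The second keeps 2^n f_n above a positive constant at all
small scales after any positive time. With the density pinned between two constants, ∑ (2^k J_k)²
grows at least linearly in the number of scales, so 2^n f_n' becomes arbitrarily large as n grows,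
against the upper bound (`DyadicCascade.false_of_source`). -/

/-! ### Absolutely continuous growth, Riccati blow-up and geometric sums -/

theorem le_sub_of_absolutelyContinuous {f : ℝ → ℝ} {s t c : ℝ} (hst : s ≤ t)
    (hf : AbsolutelyContinuousOnInterval f s t)
    (hD : ∀ᵐ u, u ∈ Ioo s t → ∃ d, HasDerivAt f d u ∧ c ≤ d) :
    c * (t - s) ≤ f t - f s := by
  rw [← hf.integral_deriv_eq_sub]
  have h1 : ∫ _ in s..t, c = c * (t - s) := by
    rw [intervalIntegral.integral_const, smul_eq_mul, mul_comm]
  rw [← h1]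
  refine intervalIntegral.integral_mono_ae_restrict hst intervalIntegrable_const
    hf.intervalIntegrable_deriv ?_
  rw [restrict_Ioo_eq_restrict_Icc.symm]
  refine (ae_restrict_iff' measurableSet_Ioo).2 ?_
  filter_upwards [hD] with u hu hmem
  obtain ⟨d, hd, hcd⟩ := hu hmem
  rw [hd.deriv]; exact hcd

theorem absolutelyContinuousOnInterval_sum {ι : Type*} (S : Finset ι) {f : ι → ℝ → ℝ} {w : ι → ℝ}
    {s t : ℝ} (hf : ∀ i, AbsolutelyContinuousOnInterval (f i) s t) :
    AbsolutelyContinuousOnInterval (fun u => ∑ i ∈ S, w i * f i u) s t := by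
  classical
  induction S using Finset.induction_on with
  | empty =>
    simp only [Finset.sum_empty]
    exact (LipschitzWith.const (0 : ℝ)).lipschitzOnWith.absolutelyContinuousOnInterval
  | insert i S hi ih =>
    simp only [Finset.sum_insert hi]
    exact ((hf i).const_mul (w i)).add ih

/-- A positive supersolution of `Y' = κ Y²` on `[s, b]` has `κ (b - s) Y(s) < 2`. -/
theorem riccati_bound {Y : ℝ → ℝ} {a b κ : ℝ} (hκ : 0 < κ)
    (hY : ∀ s t, a ≤ s → s ≤ t → t ≤ b → 0 < Y s → Y s + κ * (t - s) * Y s ^ 2 ≤ Y t)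
    {s : ℝ} (has : a ≤ s) (hsb : s ≤ b) (hpos : 0 < Y s) : κ * (b - s) * Y s < 2 := by
  have key : ∀ k : ℕ, ∀ s, a ≤ s → s ≤ b → 0 < Y s → 2 ≤ κ * (b - s) * Y s →
      2 ^ k * Y s ≤ Y b := by
    intro k
    induction k with
    | zero =>
      intro s h1 h2 h3 _
      have := hY s b h1 h2 le_rfl h3
      have h4 : 0 ≤ κ * (b - s) * Y s ^ 2 := by
        have : 0 ≤ b - s := by linarith
        positivity
      simp only [pow_zero, one_mul]; linarith
    | succ k ih =>
      intro s h1 h2 h3 h4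
      have hκY : 0 < κ * Y s := by positivity
      -- After time d the value has at least doubled, and the condition 2 ≤ κ (b - s) Y(s) survives
      -- at s + d because κ d Y(s) = 1. Doubling thus repeats indefinitely before b, although Y(b)
      -- is finite.
      set d := 1 / (κ * Y s) with hd
      have hdpos : 0 < d := by positivity
      have hdY : κ * d * Y s = 1 := by rw [hd]; field_simp
      have h5 : s + d ≤ b := by
        by_contra hcon
        push Not at hcon
        have : κ * (b - s) * Y s < κ * d * Y s := by
          have : b - s < d := by linarith
          gcongr
        linarith
      have h6 := hY s (s + d) h1 (by linarith) h5 h3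
      have h7 : κ * (s + d - s) * Y s ^ 2 = Y s := by
        have : κ * (s + d - s) * Y s ^ 2 = (κ * d * Y s) * Y s := by ring
        rw [this, hdY, one_mul]
      rw [h7] at h6
      have h8 : 2 ≤ κ * (b - (s + d)) * Y (s + d) := by
        have h9 : 0 ≤ κ * (b - (s + d)) := mul_nonneg hκ.le (by linarith)
        have h10 : κ * (b - (s + d)) * (2 * Y s) ≤ κ * (b - (s + d)) * Y (s + d) := by
          gcongr; linarith
        have h11 : κ * (b - (s + d)) * (2 * Y s) = 2 * (κ * (b - s) * Y s) - 2 * (κ * d * Y s) := by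
          ring
        linarith
      have := ih (s + d) (by linarith) h5 (by linarith) h8
      calc 2 ^ (k + 1) * Y s = 2 ^ k * (Y s + Y s) := by ring
        _ ≤ 2 ^ k * Y (s + d) := by gcongr
        _ ≤ Y b := this
  by_contra hcon
  push Not at hcon
  obtain ⟨k, hk⟩ := pow_unbounded_of_one_lt (Y b / Y s) (by norm_num : (1 : ℝ) < 2)
  have := key k s has hsb hpos hcon
  rw [div_lt_iff₀ hpos] at hk
  linarith

theorem sum_geometric_Icc_le {q : ℝ} (h0 : 0 ≤ q) (h1 : q < 1) (n N : ℕ) :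
    ∑ k ∈ Finset.Icc n N, q ^ (k - n) ≤ (1 - q)⁻¹ := by
  have h2 : ∑ k ∈ Finset.Icc n N, q ^ (k - n) = ∑ j ∈ Finset.range (N + 1 - n), q ^ j := by
    rw [← Finset.Ico_add_one_right_eq_Icc, Finset.sum_Ico_eq_sum_range]
    simp
  rw [h2, ← tsum_geometric_of_lt_one h0 h1]
  exact (summable_geometric_of_lt_one h0 h1).sum_le_tsum _ (fun _ _ => by positivity)

theorem sum_two_pow_Icc_le (n k : ℕ) : ∑ j ∈ Finset.Icc n k, (2 : ℝ) ^ j ≤ 2 * 2 ^ k := by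
  calc ∑ j ∈ Finset.Icc n k, (2 : ℝ) ^ j ≤ ∑ j ∈ Finset.range (k + 1), (2 : ℝ) ^ j := by
        refine Finset.sum_le_sum_of_subset_of_nonneg ?_ (fun _ _ _ => by positivity)
        intro j hj
        simp only [Finset.mem_Icc, Finset.mem_range] at hj ⊢
        omega
    _ = 2 ^ (k + 1) - 1 := by rw [geom_sum_eq (by norm_num)]; norm_num
    _ ≤ 2 * 2 ^ k := by rw [pow_succ]; linarith

/-! ### The dyadic cascade: upper density bound and contradiction with a source -/

/-- The differential inequalities satisfied by the masses `f n` of a solution near the origin,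
at the dyadic scale `2⁻ⁿ`, when the mass of the origin itself is constant on `[a, b]`;
`J k` is the mass of `(2⁻ᵏ⁻¹, 2⁻ᵏ]`. -/
structure DyadicCascade (a b : ℝ) (f J D : ℕ → ℝ → ℝ) : Prop where
  nonneg : ∀ n, ∀ t ∈ Icc a b, 0 ≤ f n t
  mass_nonneg : ∀ n t, 0 ≤ J n t
  antitone : ∀ t ∈ Icc a b, Antitone fun n => f n t
  tendsto : Tendsto (fun n => f n b) atTop (𝓝 0)
  le_sum : ∀ t ∈ Icc a b, ∀ n N, n ≤ N → f n t ≤ ∑ k ∈ Finset.Icc n N, J k t + 4 * f N t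
  ac : ∀ n, AbsolutelyContinuousOnInterval (f n) a b
  hasDeriv : ∀ n, ∀ᵐ u, u ∈ Ioo a b → HasDerivAt (f n) (D n u) u
  flux : ∀ n, ∀ u ∈ Ioo a b,
    (1 / 4) * (1 / 2) ^ n * ∑ k ∈ Finset.range (n + 1), (2 ^ k * J k u) ^ 2 ≤ D n u

namespace DyadicCascade

variable {a b : ℝ} {f J D : ℕ → ℝ → ℝ}

theorem growth (H : DyadicCascade a b f J D) (S : Finset ℕ) (w : ℕ → ℝ) {c s t : ℝ}
    (has : a ≤ s) (hst : s ≤ t) (htb : t ≤ b)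
    (hc : ∀ u ∈ Ioo s t, c ≤ ∑ n ∈ S, w n * D n u) :
    c * (t - s) ≤ ∑ n ∈ S, w n * f n t - ∑ n ∈ S, w n * f n s := by
  have hsub : uIcc s t ⊆ uIcc a b := by
    rw [uIcc_of_le hst, uIcc_of_le (by linarith)]
    exact Icc_subset_Icc has htb
  refine le_sub_of_absolutelyContinuous (f := fun u => ∑ n ∈ S, w n * f n u) hst
    ((absolutelyContinuousOnInterval_sum S H.ac).mono hsub) ?_
  have hall : ∀ᵐ u, ∀ n, u ∈ Ioo a b → HasDerivAt (f n) (D n u) u := ae_all_iff.2 H.hasDeriv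
  filter_upwards [hall] with u hu hmem
  refine ⟨_, HasDerivAt.fun_sum fun n _ =>
    (hu n ⟨has.trans_lt hmem.1, hmem.2.trans_le htb⟩).const_mul (w n), hc u hmem⟩

theorem growth_single (H : DyadicCascade a b f J D) (n : ℕ) {c s t : ℝ}
    (has : a ≤ s) (hst : s ≤ t) (htb : t ≤ b) (hc : ∀ u ∈ Ioo s t, c ≤ D n u) :
    c * (t - s) ≤ f n t - f n s := by
  simpa using H.growth {n} (fun _ => 1) has hst htb (by simpa using hc)

theorem deriv_nonneg (H : DyadicCascade a b f J D) (n : ℕ) {u : ℝ} (hu : u ∈ Ioo a b) :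
    0 ≤ D n u :=
  le_trans (mul_nonneg (by positivity) (Finset.sum_nonneg fun _ _ => sq_nonneg _)) (H.flux n u hu)

theorem mono (H : DyadicCascade a b f J D) (n : ℕ) {s t : ℝ}
    (has : a ≤ s) (hst : s ≤ t) (htb : t ≤ b) : f n s ≤ f n t := by
  have := H.growth_single n has hst htb (c := 0)
    fun u hu => H.deriv_nonneg n ⟨has.trans_lt hu.1, hu.2.trans_le htb⟩
  linarith

theorem flux_diag (H : DyadicCascade a b f J D) (n : ℕ) {u : ℝ} (hu : u ∈ Ioo a b) :
    (1 / 4) * 2 ^ n * J n u ^ 2 ≤ D n u := by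
  refine le_trans ?_ (H.flux n u hu)
  have h1 : (2 ^ n * J n u) ^ 2 ≤ ∑ k ∈ Finset.range (n + 1), (2 ^ k * J k u) ^ 2 :=
    Finset.single_le_sum (f := fun k => (2 ^ k * J k u) ^ 2) (fun _ _ => sq_nonneg _)
      (Finset.self_mem_range_succ n)
  calc (1 / 4) * 2 ^ n * J n u ^ 2 = (1 / 4) * (1 / 2) ^ n * (2 ^ n * J n u) ^ 2 := by
        have : ((1 : ℝ) / 2) ^ n * 2 ^ n = 1 := by rw [← mul_pow]; norm_num
        linear_combination (-((1 / 4) * 2 ^ n * J n u ^ 2)) * this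
    _ ≤ _ := by gcongr

/-- The weighted sums of the masses satisfy a Riccati inequality; as they stay finite, the mean
density at each scale is controlled by the remaining time. -/
theorem density_le (H : DyadicCascade a b f J D) (n : ℕ) {s : ℝ} (has : a ≤ s) (hsb : s < b) :
    2 ^ n * f n s ≤ 288 / (b - s) := by
  have hbs : 0 < b - s := by linarith
  have main : ∀ N, n ≤ N → 2 ^ n * f n s ≤ 288 / (b - s) + 12 * 2 ^ n * f N b := by
    intro N hN
    -- The ratio 2/3 is below 1, so the weights sum to at most 3; it is above 1/2, so against the
    -- fluxes 2^k J_k² the inverse weights (3/4)^(k-n) are summable too, with sum at most 4 in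
    -- Cauchy–Schwarz. Subtracting 4 f_N(b) absorbs the remainder in `le_sum`, so that Y is bounded
    -- by the shell masses alone.
    set X : ℝ → ℝ := fun t => ∑ k ∈ Finset.Icc n N, (2 / 3 : ℝ) ^ (k - n) * f k t with hX
    set Y : ℝ → ℝ := fun t => X t / 3 - 4 * f N b with hYdef
    have hnN : n ∈ Finset.Icc n N := by simp [hN]
    have hXle : ∀ t, a ≤ t → t ≤ b → Y t ≤ ∑ k ∈ Finset.Icc n N, J k t := by
      intro t h1 h2
      have h3 : X t ≤ 3 * f n t := by
        calc X t ≤ ∑ k ∈ Finset.Icc n N, (2 / 3 : ℝ) ^ (k - n) * f n t := by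
              refine Finset.sum_le_sum fun k hk => ?_
              have := H.antitone t ⟨h1, h2⟩ (Finset.mem_Icc.1 hk).1
              simp only at this
              gcongr
          _ = (∑ k ∈ Finset.Icc n N, (2 / 3 : ℝ) ^ (k - n)) * f n t := by rw [Finset.sum_mul]
          _ ≤ 3 * f n t := by
              have := sum_geometric_Icc_le (q := 2 / 3) (by norm_num) (by norm_num) n N
              have h4 := H.nonneg n t ⟨h1, h2⟩
              gcongr
              norm_num at this ⊢
              exact this
      have h4 := H.le_sum t ⟨h1, h2⟩ n N hN
      have h5 := H.mono N h1 h2 le_rfl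
      simp only [hYdef]; linarith
    have hXmono : ∀ t u, a ≤ t → t ≤ u → u ≤ b → Y t ≤ Y u := by
      intro t u h1 h2 h3
      have : X t ≤ X u := Finset.sum_le_sum fun k _ => by
        have := H.mono k h1 h2 h3
        gcongr
      simp only [hYdef]; linarith
    have hric : ∀ t u, a ≤ t → t ≤ u → u ≤ b → 0 < Y t →
        Y t + (2 ^ n / 48) * (u - t) * Y t ^ 2 ≤ Y u := by
      intro t u h1 h2 h3 h4
      have := H.growth (Finset.Icc n N) (fun k => (2 / 3 : ℝ) ^ (k - n)) (c := 2 ^ n / 16 * Y t ^ 2)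
        h1 h2 h3 ?_
      · have h6 : 2 ^ n / 16 * Y t ^ 2 * (u - t) ≤ X u - X t := this
        simp only [hYdef] at h6 ⊢
        nlinarith
      · intro v hv
        have hvab : v ∈ Ioo a b := ⟨h1.trans_lt hv.1, hv.2.trans_le h3⟩
        have h5 : Y t ≤ ∑ k ∈ Finset.Icc n N, J k v :=
          (hXmono t v h1 hv.1.le hvab.2.le).trans (hXle v hvab.1.le hvab.2.le)
        have h6 := Finset.sq_sum_div_le_sum_sq_div (Finset.Icc n N) (fun k => J k v)
          (g := fun k => (3 / 4 : ℝ) ^ (k - n)) (fun _ _ => by positivity)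
        have h7 := sum_geometric_Icc_le (q := 3 / 4) (by norm_num) (by norm_num) n N
        have h8 : 0 < ∑ k ∈ Finset.Icc n N, (3 / 4 : ℝ) ^ (k - n) :=
          Finset.sum_pos (fun _ _ => by positivity) ⟨n, hnN⟩
        have h9 : Y t ^ 2 / 4 ≤ ∑ k ∈ Finset.Icc n N, J k v ^ 2 / (3 / 4 : ℝ) ^ (k - n) := by
          refine le_trans ?_ h6
          gcongr
          norm_num at h7 ⊢
          exact h7
        calc 2 ^ n / 16 * Y t ^ 2 = 2 ^ n / 4 * (Y t ^ 2 / 4) := by ring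
          _ ≤ 2 ^ n / 4 * ∑ k ∈ Finset.Icc n N, J k v ^ 2 / (3 / 4 : ℝ) ^ (k - n) := by gcongr
          _ = ∑ k ∈ Finset.Icc n N, (2 / 3 : ℝ) ^ (k - n) * ((1 / 4) * 2 ^ k * J k v ^ 2) := by
              rw [Finset.mul_sum]
              refine Finset.sum_congr rfl fun k hk => ?_
              obtain ⟨j, rfl⟩ := Nat.exists_eq_add_of_le (Finset.mem_Icc.1 hk).1
              simp only [Nat.add_sub_cancel_left]
              have : (2 / 3 : ℝ) ^ j * 2 ^ j * (3 / 4) ^ j = 1 := by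
                rw [← mul_pow, ← mul_pow]; norm_num
              rw [mul_div_assoc', div_eq_iff (by positivity), pow_add]
              linear_combination (-(2 ^ n / 4 * J (n + j) v ^ 2)) * this
          _ ≤ _ := Finset.sum_le_sum fun k _ => by
              have := H.flux_diag k hvab
              gcongr
    have hfX : f n s ≤ X s := by
      have := Finset.single_le_sum (f := fun k => (2 / 3 : ℝ) ^ (k - n) * f k s)
        (fun k _ => mul_nonneg (by positivity) (H.nonneg k s ⟨has, hsb.le⟩)) hnN
      simpa using this
    -- The Riccati constant 2^n / 48 gives 2 · 48 = 96; passing back to f_n ≤ 3 Y + 12 f_N(b)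
    -- triples this to 288, and the remainder vanishes as N → ∞.
    have hYs : 2 ^ n * Y s ≤ 96 / (b - s) := by
      rcases le_or_gt (Y s) 0 with h | h
      · have : 2 ^ n * Y s ≤ 0 := mul_nonpos_of_nonneg_of_nonpos (by positivity) h
        exact this.trans (by positivity)
      · have := riccati_bound (κ := 2 ^ n / 48) (by positivity) hric has hsb.le h
        rw [le_div_iff₀ hbs]
        nlinarith
    have : f n s ≤ 3 * Y s + 12 * f N b := by simp only [hYdef]; linarith
    calc 2 ^ n * f n s ≤ 2 ^ n * (3 * Y s + 12 * f N b) := by gcongr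
      _ = 3 * (2 ^ n * Y s) + 12 * 2 ^ n * f N b := by ring
      _ ≤ 3 * (96 / (b - s)) + 12 * 2 ^ n * f N b := by gcongr
      _ = _ := by ring
  have hlim : Tendsto (fun N => 288 / (b - s) + 12 * 2 ^ n * f N b) atTop
      (𝓝 (288 / (b - s) + 12 * 2 ^ n * 0)) := (H.tendsto.const_mul _).const_add _
  rw [mul_zero, add_zero] at hlim
  exact ge_of_tendsto hlim (eventually_atTop.2 ⟨n, main⟩)

/-- With a source of size `2⁻ⁿ` at every small scale, the density at the origin diverges. -/
theorem false_of_source (H : DyadicCascade a b f J D) (hab : a < b) {c₀ : ℝ} (hc₀ : 0 < c₀)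
    (m : ℕ) (hsrc : ∀ n, m ≤ n → ∀ u ∈ Ioo a b, c₀ * (1 / 2) ^ n ≤ D n u) : False := by
  -- On [a, p] the source builds a lower bound for the density, on [p, q] the quadratic flux acts,
  -- and [q, b] is the spare time that keeps the upper bound finite up to q.
  set p := (3 * a + b) / 4 with hp
  set q := (a + b) / 2 with hq
  have hap : a < p := by rw [hp]; linarith
  have hpq : p < q := by rw [hp, hq]; linarith
  have hqb : q < b := by rw [hq]; linarith
  set K := 288 / (b - q) with hK
  have hKpos : 0 < K := div_pos (by norm_num) (by linarith)
  have hdens : ∀ n, ∀ u, a ≤ u → u ≤ q → 2 ^ n * f n u ≤ K := fun n u h1 h2 =>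
    (mul_le_mul_of_nonneg_left (H.mono n h1 h2 hqb.le) (by positivity)).trans
      (H.density_le n (hap.trans hpq).le hqb)
  have h2half : ∀ n : ℕ, (2 : ℝ) ^ n * (1 / 2) ^ n = 1 := fun n => by
    rw [← mul_pow]; norm_num
  set g := c₀ * (p - a) with hg
  have hgpos : 0 < g := mul_pos hc₀ (by linarith)
  have hlow : ∀ n, m ≤ n → ∀ u, p ≤ u → u ≤ q → g ≤ 2 ^ n * f n u := by
    intro n hn u h1 h2
    have h3 := H.growth_single n (c := c₀ * (1 / 2) ^ n) le_rfl hap.le (hpq.trans hqb).le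
      fun v hv => hsrc n hn v ⟨hv.1, hv.2.trans (hpq.trans hqb)⟩
    have h4 := H.nonneg n a ⟨le_rfl, hab.le⟩
    have h5 := H.mono n hap.le h1 (h2.trans hqb.le)
    calc g = 2 ^ n * (c₀ * (1 / 2) ^ n * (p - a)) := by
          rw [hg]; linear_combination (-(c₀ * (p - a))) * h2half n
      _ ≤ 2 ^ n * f n u := by gcongr; linarith
  -- L is the number of scales used. The first bound makes the tail 8 K at most half of L g; the
  -- second makes the final gain L g² (q - p) / 64 exceed K.
  obtain ⟨L, hL⟩ := exists_nat_gt (max (16 * K / g) (64 * K / (g ^ 2 * (q - p))))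
  have hL1 : 16 * K < L * g := by
    rw [← div_lt_iff₀ hgpos]; exact (le_max_left _ _).trans_lt hL
  have hL2 : 64 * K < L * (g ^ 2 * (q - p)) := by
    rw [← div_lt_iff₀ (mul_pos (by positivity) (by linarith))]
    exact (le_max_right _ _).trans_lt hL
  have hLpos : 0 < (L : ℝ) := by
    by_contra hcon
    have : (L : ℝ) * g ≤ 0 := mul_nonpos_of_nonpos_of_nonneg (by linarith) hgpos.le
    linarith
  have hLnat : 0 < L := by exact_mod_cast hLpos
  set N := m + L - 1 with hN
  have hmN : m ≤ N := by omega
  have hcard : (Finset.Icc m N).card = L := by rw [Nat.card_Icc]; omega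
  have hsum : ∀ u, p ≤ u → u ≤ q → L * g / 4 ≤ ∑ k ∈ Finset.Icc m N, 2 ^ k * J k u := by
    intro u h1 h2
    have hu : u ∈ Icc a b := ⟨by linarith, by linarith⟩
    have h3 : L * g ≤ ∑ n ∈ Finset.Icc m N, 2 ^ n * f n u := by
      have := Finset.card_nsmul_le_sum (Finset.Icc m N) (fun n => 2 ^ n * f n u) g
        fun n hn => hlow n (Finset.mem_Icc.1 hn).1 u h1 h2
      rwa [hcard, nsmul_eq_mul] at this
    have h4 : ∑ n ∈ Finset.Icc m N, 2 ^ n * f n u ≤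
        ∑ n ∈ Finset.Icc m N, ∑ k ∈ Finset.Icc n N, 2 ^ n * J k u +
          ∑ n ∈ Finset.Icc m N, 2 ^ n * (4 * f N u) := by
      rw [← Finset.sum_add_distrib]
      refine Finset.sum_le_sum fun n hn => ?_
      rw [← Finset.mul_sum, ← mul_add]
      have := H.le_sum u hu n N (Finset.mem_Icc.1 hn).2
      gcongr
    -- After exchanging the sums, each J_k is counted with weight 2^m + ... + 2^k ≤ 2 · 2^k.
    have h5 : ∑ n ∈ Finset.Icc m N, ∑ k ∈ Finset.Icc n N, 2 ^ n * J k u =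
        ∑ k ∈ Finset.Icc m N, ∑ n ∈ Finset.Icc m k, 2 ^ n * J k u :=
      Finset.sum_comm' fun n k => by simp only [Finset.mem_Icc]; omega
    have h6 : ∑ k ∈ Finset.Icc m N, ∑ n ∈ Finset.Icc m k, 2 ^ n * J k u ≤
        2 * ∑ k ∈ Finset.Icc m N, 2 ^ k * J k u := by
      rw [Finset.mul_sum]
      refine Finset.sum_le_sum fun k _ => ?_
      rw [← Finset.sum_mul, ← mul_assoc]
      have := sum_two_pow_Icc_le m k
      have := H.mass_nonneg k u
      gcongr
    have h7 : ∑ n ∈ Finset.Icc m N, 2 ^ n * (4 * f N u) ≤ 8 * K := by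
      rw [← Finset.sum_mul]
      have h8 := sum_two_pow_Icc_le m N
      have h9 := H.nonneg N u hu
      calc (∑ n ∈ Finset.Icc m N, (2 : ℝ) ^ n) * (4 * f N u) ≤ 2 * 2 ^ N * (4 * f N u) := by
            gcongr
        _ = 8 * (2 ^ N * f N u) := by ring
        _ ≤ 8 * K := by
            have := hdens N u hu.1 h2
            gcongr
    linarith
  have hfin := H.growth_single N (c := (1 / 4) * (1 / 2) ^ N * (L * g ^ 2 / 16)) hap.le hpq.le
    hqb.le ?_
  · have h1 := hdens N q (hap.trans hpq).le le_rfl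
    have h2 := H.nonneg N p ⟨hap.le, (hpq.trans hqb).le⟩
    have h3 : (1 / 4) * (L * g ^ 2 / 16) * (q - p) ≤ 2 ^ N * f N q := by
      calc (1 / 4) * (L * g ^ 2 / 16) * (q - p)
          = 2 ^ N * ((1 / 4) * (1 / 2) ^ N * (L * g ^ 2 / 16) * (q - p)) := by
            linear_combination (-((1 / 4) * (L * g ^ 2 / 16) * (q - p))) * h2half N
        _ ≤ 2 ^ N * f N q := by gcongr; linarith
    nlinarith
  · intro u hu
    have huab : u ∈ Ioo a b := ⟨by linarith [hu.1], by linarith [hu.2]⟩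
    refine le_trans ?_ (H.flux N u huab)
    gcongr
    have h1 := hsum u hu.1.le hu.2.le
    -- Cauchy–Schwarz over L scales: a sum at least L g / 4 has sum of squares at least L g² / 16,
    -- still linear in L.
    have h2 := sq_sum_le_card_mul_sum_sq (s := Finset.Icc m N) (f := fun k => 2 ^ k * J k u)
    rw [hcard] at h2
    have h3 : ∑ k ∈ Finset.Icc m N, (2 ^ k * J k u) ^ 2 ≤
        ∑ k ∈ Finset.range (N + 1), (2 ^ k * J k u) ^ 2 :=
      Finset.sum_le_sum_of_subset_of_nonneg
        (fun k hk => by simp only [Finset.mem_Icc, Finset.mem_range] at hk ⊢; omega)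
        fun _ _ _ => sq_nonneg _
    refine le_trans ?_ h3
    have h4 : (L * g / 4) ^ 2 ≤ L * ∑ k ∈ Finset.Icc m N, (2 ^ k * J k u) ^ 2 := by
      refine le_trans ?_ h2
      gcongr
    have h5 : (L : ℝ) * (L * g ^ 2 / 16) ≤ L * ∑ k ∈ Finset.Icc m N, (2 ^ k * J k u) ^ 2 := by
      refine le_trans (le_of_eq ?_) h4
      ring
    exact le_of_mul_le_mul_left h5 hLpos

end DyadicCascade

/-! ### The convex test functions and pointwise bounds for Λ -/

/-- An exponent of at least 2 makes the function o(v) at the kink. The case k = 0 differentiates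
`bump`, the case k = 1 its primitive. -/
theorem hasDerivAt_max_zero_pow (k : ℕ) (u : ℝ) :
    HasDerivAt (fun v : ℝ => (max v 0) ^ (k + 2)) ((k + 2) * (max u 0) ^ (k + 1)) u := by
  rcases lt_trichotomy u 0 with h | rfl | h
  · have h1 : (fun v : ℝ => (max v 0) ^ (k + 2)) =ᶠ[𝓝 u] fun _ => 0 := by
      filter_upwards [Iio_mem_nhds h] with v hv
      rw [max_eq_right (le_of_lt hv), zero_pow (by omega)]
    rw [max_eq_right h.le, zero_pow (by omega), mul_zero]
    exact (hasDerivAt_const u (0 : ℝ)).congr_of_eventuallyEq h1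
  · rw [max_self, zero_pow (by omega), mul_zero, hasDerivAt_iff_isLittleO_nhds_zero]
    simp only [zero_add, max_self, smul_zero, sub_zero, ne_eq, Nat.add_eq_zero_iff,
      OfNat.ofNat_ne_zero, and_false, not_false_eq_true, zero_pow]
    have h2 : (fun v : ℝ => (max v 0) ^ (k + 2)) =O[𝓝 0] fun v : ℝ => v ^ (k + 2) := by
      refine Asymptotics.IsBigO.of_bound' (Eventually.of_forall fun v => ?_)
      rw [norm_pow, norm_pow]
      refine pow_le_pow_left₀ (norm_nonneg _) ?_ _
      rw [Real.norm_eq_abs, Real.norm_eq_abs, abs_of_nonneg (le_max_right _ _)]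
      exact max_le (le_abs_self v) (abs_nonneg v)
    exact h2.trans_isLittleO (Asymptotics.isLittleO_pow_id (by omega))
  · have h1 : (fun v : ℝ => (max v 0) ^ (k + 2)) =ᶠ[𝓝 u] fun v => v ^ (k + 2) := by
      filter_upwards [Ioi_mem_nhds h] with v hv
      rw [max_eq_left (le_of_lt hv)]
    rw [max_eq_left h.le]
    have := (hasDerivAt_pow (k + 2) u).congr_of_eventuallyEq h1
    simpa using this

/-- The convex test function `(1 - c x)₊²`, concentrated at the scale `1 / c`. -/
noncomputable def bump (c x : ℝ) : ℝ := (max (1 - c * x) 0) ^ 2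

theorem hasDerivAt_bump (c x : ℝ) : HasDerivAt (bump c) (-(2 * c * max (1 - c * x) 0)) x := by
  have h1 : HasDerivAt (fun x : ℝ => 1 - c * x) (-c) x := by
    simpa using ((hasDerivAt_id x).const_mul c).const_sub 1
  have h2 := (hasDerivAt_max_zero_pow 0 (1 - c * x)).comp x h1
  refine h2.congr_deriv ?_
  simp; ring

theorem continuous_bump (c : ℝ) : Continuous (bump c) := by unfold bump; fun_prop

theorem contDiff_bump (c : ℝ) : ContDiff ℝ 1 (bump c) := by
  rw [contDiff_one_iff_deriv]
  refine ⟨fun x => (hasDerivAt_bump c x).differentiableAt, ?_⟩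
  have : deriv (bump c) = fun x => -(2 * c * max (1 - c * x) 0) :=
    funext fun x => (hasDerivAt_bump c x).deriv
  rw [this]; fun_prop

theorem bump_nonneg (c x : ℝ) : 0 ≤ bump c x := sq_nonneg _

theorem bump_zero (c : ℝ) : bump c 0 = 1 := by simp [bump]

theorem max_one_sub_le {c x : ℝ} (hc : 0 ≤ c) (hx : 0 ≤ x) : max (1 - c * x) 0 ≤ 1 :=
  max_le (by nlinarith [mul_nonneg hc hx]) zero_le_one

theorem bump_le_one {c x : ℝ} (hc : 0 ≤ c) (hx : 0 ≤ x) : bump c x ≤ 1 :=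
  pow_le_one₀ (le_max_right _ _) (max_one_sub_le hc hx)

theorem bump_eq_zero {c x : ℝ} (hx : 1 ≤ c * x) : bump c x = 0 := by
  rw [bump, max_eq_right (by linarith), zero_pow two_ne_zero]

theorem bump_anti {c x y : ℝ} (hc : 0 ≤ c) (hxy : x ≤ y) : bump c y ≤ bump c x := by
  have : 1 - c * y ≤ 1 - c * x := by nlinarith
  exact pow_le_pow_left₀ (le_max_right _ _) (max_le_max_right 0 this) 2

theorem bump_anti_scale {c d x : ℝ} (hcd : c ≤ d) (hx : 0 ≤ x) : bump d x ≤ bump c x := by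
  have : 1 - d * x ≤ 1 - c * x := by nlinarith
  exact pow_le_pow_left₀ (le_max_right _ _) (max_le_max_right 0 this) 2

theorem isC1b_bump {c : ℝ} (hc : 0 ≤ c) : IsC1b (bump c) := by
  refine ⟨(contDiff_bump c).contDiffOn, ⟨1, fun x hx => ?_⟩, 2 * c, fun x hx => ?_⟩
  · rw [abs_of_nonneg (bump_nonneg c x)]; exact bump_le_one hc hx
  · rw [(hasDerivAt_bump c x).hasDerivWithinAt.derivWithin (uniqueDiffOn_Ici 0 x hx), abs_neg,
      abs_of_nonneg (by positivity)]
    exact mul_le_of_le_one_right (by positivity) (max_one_sub_le hc hx)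

theorem isC1b_one_sub_bump {c : ℝ} (hc : 0 ≤ c) : IsC1b (fun x => 1 - bump c x) := by
  refine ⟨(contDiff_const.sub (contDiff_bump c)).contDiffOn, ⟨1, fun x hx => ?_⟩, 2 * c,
    fun x hx => ?_⟩
  · have := bump_nonneg c x
    have := bump_le_one hc hx
    rw [abs_of_nonneg (by linarith)]; linarith
  · rw [((hasDerivAt_bump c x).const_sub 1).hasDerivWithinAt.derivWithin
      (uniqueDiffOn_Ici 0 x hx), neg_neg, abs_of_nonneg (by positivity)]
    exact mul_le_of_le_one_right (by positivity) (max_one_sub_le hc hx)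

theorem Lam_comm (φ : ℝ → ℝ) (x y : ℝ) : Lam φ x y = Lam φ y x := by
  rw [Lam, Lam, add_comm x y, abs_sub_comm, max_comm]

theorem Lam_of_le (φ : ℝ → ℝ) {x y : ℝ} (h : y ≤ x) :
    Lam φ x y = φ (x + y) + φ (x - y) - 2 * φ x := by
  rw [Lam, abs_of_nonneg (by linarith), max_eq_left h]

/-- For y ≤ x the points x + y and x - y are symmetric about x = max x y, so this is midpoint
convexity. -/
theorem Lam_bump_nonneg (c x y : ℝ) : 0 ≤ Lam (bump c) x y := by
  wlog h : y ≤ x generalizing x y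
  · rw [Lam_comm]; exact this y x (by linarith)
  rw [Lam_of_le _ h]
  unfold bump
  set p := max (1 - c * (x + y)) 0
  set q := max (1 - c * (x - y)) 0
  set r := max (1 - c * x) 0
  have hr0 : 0 ≤ r := le_max_right _ _
  have hp1 : 1 - c * (x + y) ≤ p := le_max_left _ _
  have hp0 : 0 ≤ p := le_max_right _ _
  have hq1 : 1 - c * (x - y) ≤ q := le_max_left _ _
  have hq0 : 0 ≤ q := le_max_right _ _
  have hr : r ≤ (p + q) / 2 := max_le (by linarith) (by linarith)
  nlinarith [sq_nonneg (p - q)]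

/-- On [0, ∞) the test function is nonincreasing with slope at most 2c in absolute value. Since min
x y ≤ √(xy), the bound cancels the singular weight and makes the quadratic integrand bounded. -/
theorem Lam_bump_le {c x y : ℝ} (hc : 0 ≤ c) (hx : 0 ≤ x) (hy : 0 ≤ y) :
    Lam (bump c) x y ≤ 2 * c * min x y := by
  wlog h : y ≤ x generalizing x y
  · rw [Lam_comm, min_comm]; exact this hy hx (by linarith)
  rw [Lam_of_le _ h, min_eq_right h]
  have h1 : bump c (x + y) ≤ bump c x := bump_anti hc (by linarith)
  have h2 : bump c (x - y) ≤ bump c x + 2 * c * y := by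
    unfold bump
    have h3 := max_one_sub_le hc hx
    have h4 := max_one_sub_le hc (show 0 ≤ x - y by linarith)
    set q := max (1 - c * (x - y)) 0
    set r := max (1 - c * x) 0
    have hr0 : 0 ≤ r := le_max_right _ _
    have hr1 : 1 - c * x ≤ r := le_max_left _ _
    have hcy : 0 ≤ c * y := by positivity
    have hq : q ≤ r + c * y := max_le (by linarith) (by linarith)
    have hq0 : 0 ≤ q := le_max_right _ _
    nlinarith
  linarith

/-- Two points beyond half the scale and close to each other send mass to |x - y|, where the test
function is at least 1/4. If c x ≤ 1, the loss 2 (1 - c x)² is paid for by the gain (1 - c x + c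
y)². -/
theorem quarter_le_Lam_bump {c x y : ℝ} (hx : 1 / 2 ≤ c * x) (hy : 1 / 2 ≤ c * y)
    (hxy : c * |x - y| ≤ 1 / 2) : 1 / 4 ≤ Lam (bump c) x y := by
  wlog h : y ≤ x generalizing x y
  · rw [Lam_comm]; exact this hy hx (by rwa [abs_sub_comm]) (by linarith)
  rw [abs_of_nonneg (by linarith)] at hxy
  rw [Lam_of_le _ h]
  have h1 := bump_nonneg c (x + y)
  rcases le_total 1 (c * x) with h2 | h2
  · rw [bump_eq_zero h2]
    have : 1 / 4 ≤ bump c (x - y) := by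
      rw [bump, max_eq_left (by linarith)]
      nlinarith
    linarith
  · have h3 : bump c (x - y) = (1 - c * x + c * y) ^ 2 := by
      rw [bump, max_eq_left (by linarith)]; ring
    have h4 : bump c x = (1 - c * x) ^ 2 := by rw [bump, max_eq_left (by linarith)]
    rw [h3, h4]
    nlinarith

/-- The factor √(xy) cancels the kernel, and the remaining factor is the concave observable 1 -
`bump 1`; integrated, this closes a Grönwall estimate. For y ≤ x ≤ 1 the left side is at most 2 y².
-/
theorem Lam_bump_one_le {x y : ℝ} (hx : 0 ≤ x) (hy : 0 ≤ y) :
    Lam (bump 1) x y ≤ 2 * ((1 - bump 1 x) + (1 - bump 1 y)) * √(x * y) := by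
  wlog h : y ≤ x generalizing x y
  · rw [Lam_comm, mul_comm x y, add_comm]; exact this hy hx (by linarith)
  have hy1 : 0 ≤ 1 - bump 1 y := by linarith [bump_le_one zero_le_one hy]
  have hsq : y ≤ √(x * y) := Real.le_sqrt_of_sq_le (by nlinarith)
  have hs0 := Real.sqrt_nonneg (x * y)
  suffices hs : Lam (bump 1) x y ≤ 2 * (1 - bump 1 x) * √(x * y) by nlinarith
  rcases le_total 1 x with h1 | h1
  · have h2 := Lam_bump_le zero_le_one hx hy
    rw [min_eq_right h] at h2
    rw [bump_eq_zero (by linarith : 1 ≤ 1 * x)]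
    linarith
  · rw [Lam_of_le _ h]
    have e1 : bump 1 x = (1 - x) ^ 2 := by rw [bump, max_eq_left (by linarith)]; ring
    have e2 : bump 1 (x - y) = (1 - x + y) ^ 2 := by rw [bump, max_eq_left (by linarith)]; ring
    have e3 : bump 1 (x + y) ≤ (1 - x) ^ 2 - 2 * (1 - x) * y + y ^ 2 := by
      have : bump 1 (x + y) ≤ (1 - x - y) ^ 2 := by
        unfold bump
        rcases le_total 0 (1 - 1 * (x + y)) with h3 | h3
        · rw [max_eq_left h3]; nlinarith
        · rw [max_eq_right h3]; nlinarith [sq_nonneg (1 - x - y)]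
      linarith
    have h5 : x ≤ 1 - bump 1 x := by rw [e1]; nlinarith
    have h6 : x * y ≤ (1 - bump 1 x) * √(x * y) := mul_le_mul h5 hsq hy (by linarith)
    rw [e2]
    nlinarith

/-! ### The linear operator L on the test functions -/

theorem integral_bump {c : ℝ} (hc : 0 < c) (x : ℝ) :
    ∫ y in (0 : ℝ)..x, bump c y = (1 - (max (1 - c * x) 0) ^ 3) / (3 * c) := by
  have hderiv : ∀ y ∈ uIcc 0 x,
      HasDerivAt (fun y => -((max (1 - c * y) 0) ^ 3) / (3 * c)) (bump c y) y := by
    intro y _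
    have h1 : HasDerivAt (fun x : ℝ => 1 - c * x) (-c) y := by
      simpa using ((hasDerivAt_id y).const_mul c).const_sub 1
    have h2 := (((hasDerivAt_max_zero_pow 1 (1 - c * y)).comp y h1).neg.div_const (3 * c))
    refine h2.congr_deriv ?_
    simp only [bump]
    field_simp
    norm_num
  rw [intervalIntegral.integral_eq_sub_of_hasDerivAt hderiv
    ((continuous_bump c).intervalIntegrable 0 x)]
  simp
  ring

theorem calL_bump {c : ℝ} (hc : 0 < c) (x : ℝ) :
    calL (bump c) x = x * bump c x - 2 * ((1 - (max (1 - c * x) 0) ^ 3) / (3 * c)) := by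
  rw [calL, integral_bump hc]

/-- Beyond the support only the full integral of the test function remains. This value is the source
at scale 1/c: all points x ≥ 1/c contribute equally, up to the weight 1/√x. -/
theorem calL_bump_of_le {c x : ℝ} (hc : 0 < c) (hx : 1 ≤ c * x) :
    calL (bump c) x = -(2 / (3 * c)) := by
  rw [calL_bump hc, bump_eq_zero hx, max_eq_right (by linarith)]
  ring

theorem calL_bump_of_ge {c x : ℝ} (hc : 0 < c) (hx : c * x ≤ 1) :
    calL (bump c) x = -(x - c ^ 2 * x ^ 3 / 3) := by
  rw [calL_bump hc, bump, max_eq_left (by linarith)]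
  field_simp
  ring

theorem calL_bump_nonpos {c x : ℝ} (hc : 0 < c) (hx : 0 ≤ x) : calL (bump c) x ≤ 0 := by
  rcases le_total 1 (c * x) with h | h
  · rw [calL_bump_of_le hc h]
    exact neg_nonpos.2 (by positivity)
  · rw [calL_bump_of_ge hc h]
    have h1 : (c * x) ^ 2 * x ≤ 1 * x := by
      gcongr
      exact pow_le_one₀ (by positivity) h
    nlinarith

theorem neg_calL_bump_le_self {c x : ℝ} (hc : 0 < c) (hx : 0 ≤ x) : -calL (bump c) x ≤ x := by
  rcases le_total 1 (c * x) with h | h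
  · rw [calL_bump_of_le hc h, neg_neg, div_le_iff₀ (by positivity)]
    linarith
  · rw [calL_bump_of_ge hc h]
    have : 0 ≤ c ^ 2 * x ^ 3 / 3 := by positivity
    linarith

theorem neg_calL_bump_le_const {c x : ℝ} (hc : 0 < c) (hx : 0 ≤ x) :
    -calL (bump c) x ≤ 2 / (3 * c) := by
  rw [calL_bump hc]
  have h1 : 0 ≤ x * bump c x := mul_nonneg hx (bump_nonneg c x)
  have h2 : 2 * ((1 - (max (1 - c * x) 0) ^ 3) / (3 * c)) ≤ 2 / (3 * c) := by
    rw [mul_div_assoc']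
    gcongr
    have : 0 ≤ (max (1 - c * x) 0) ^ 3 := pow_nonneg (le_max_right _ _) 3
    linarith
  linarith

theorem abs_calL_bump_le {c x : ℝ} (hc : 0 < c) (hx : 0 ≤ x) :
    |calL (bump c) x| ≤ (1 + 2 / (3 * c)) * √x := by
  rw [abs_of_nonpos (calL_bump_nonpos hc hx)]
  have h0 : 0 ≤ 2 / (3 * c) := by positivity
  have hs := Real.sqrt_nonneg x
  have hss := Real.mul_self_sqrt hx
  rcases le_total 1 x with h | h
  · have h1 : 1 ≤ √x := Real.one_le_sqrt.2 h
    have := neg_calL_bump_le_const hc hx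
    nlinarith
  · have h1 : √x ≤ 1 := Real.sqrt_le_one.2 h
    have := neg_calL_bump_le_self hc hx
    nlinarith

/-- The function is concave on [0, ∞) and vanishes at 0, so its integral up to x is at least the
area x φ(x) / 2 of the triangle under the chord. -/
theorem calL_one_sub_bump_nonpos {x : ℝ} (hx : 0 ≤ x) : calL (fun y => 1 - bump 1 y) x ≤ 0 := by
  have h1 : ∫ y in (0 : ℝ)..x, (1 - bump 1 y) = x - (1 - (max (1 - 1 * x) 0) ^ 3) / (3 * 1) := by
    rw [intervalIntegral.integral_sub intervalIntegrable_const
      ((continuous_bump 1).intervalIntegrable 0 x), integral_bump one_pos]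
    simp
  rw [calL, h1, bump]
  rcases le_total 1 x with h | h
  · rw [max_eq_right (by linarith)]; nlinarith
  · rw [max_eq_left (by linarith)]
    nlinarith [pow_nonneg hx 3]

/-! ### Dyadic lower bound for the quadratic term -/

theorem min_le_sqrt_mul {x y : ℝ} (hx : 0 ≤ x) (hy : 0 ≤ y) : min x y ≤ √(x * y) := by
  refine Real.le_sqrt_of_sq_le ?_
  rw [sq]
  exact mul_le_mul (min_le_left _ _) (min_le_right _ _) (le_min hx hy) hx

theorem integrable_Lam_bump (μ : FiniteMeasure ℝ≥0) {c : ℝ} (hc : 0 ≤ c) :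
    Integrable (fun p : ℝ≥0 × ℝ≥0 => Lam (bump c) p.1 p.2 / √((p.1 : ℝ) * p.2))
      ((μ : Measure ℝ≥0).prod (μ : Measure ℝ≥0)) := by
  have hcont := continuous_bump c
  refine Integrable.of_bound (C := 2 * c) ?_ (Eventually.of_forall fun p => ?_)
  · refine Measurable.aestronglyMeasurable (Measurable.div ?_ ?_)
    · refine Continuous.measurable ?_
      unfold Lam
      fun_prop
    · exact Continuous.measurable (by fun_prop)
  · rw [Real.norm_eq_abs, abs_of_nonneg (div_nonneg (Lam_bump_nonneg _ _ _) (Real.sqrt_nonneg _))]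
    refine div_le_of_le_mul₀ (Real.sqrt_nonneg _) (by positivity) ?_
    refine (Lam_bump_le hc p.1.2 p.2.2).trans ?_
    have := min_le_sqrt_mul p.1.2 p.2.2
    gcongr
    exact this

theorem Q32_bump_nonneg (μ : FiniteMeasure ℝ≥0) (c : ℝ) : 0 ≤ Q32 (bump c) μ :=
  integral_nonneg fun _ => div_nonneg (Lam_bump_nonneg _ _ _) (Real.sqrt_nonneg _)

/-- The dyadic shell `(2⁻ᵏ⁻¹, 2⁻ᵏ]`. -/
def shell (k : ℕ) : Set ℝ≥0 := {x | (1 / 2 : ℝ) ^ (k + 1) < x ∧ (x : ℝ) ≤ (1 / 2) ^ k}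

/-- The interval `(j ε, (j + 1) ε]`. -/
def cell (ε : ℝ) (j : ℕ) : Set ℝ≥0 := {x | j * ε < (x : ℝ) ∧ (x : ℝ) ≤ (j + 1) * ε}

theorem measurableSet_cell (ε : ℝ) (j : ℕ) : MeasurableSet (cell ε j) :=
  (measurableSet_lt measurable_const measurable_subtype_coe).inter
    (measurableSet_le measurable_subtype_coe measurable_const)

theorem disjoint_cell {ε : ℝ} (hε : 0 < ε) {i j : ℕ} (hij : i ≠ j) :
    Disjoint (cell ε i) (cell ε j) := by
  wlog h : i < j generalizing i j
  · exact (this hij.symm (by omega)).symm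
  rw [Set.disjoint_left]
  rintro x ⟨-, h1⟩ ⟨h2, -⟩
  have h3 : ((i : ℝ) + 1) ≤ j := by exact_mod_cast h
  have : ((i : ℝ) + 1) * ε ≤ j * ε := by gcongr
  linarith

theorem shell_subset_cells {k n : ℕ} (hk : k ≤ n) :
    shell k ⊆ ⋃ j ∈ Finset.Ico (2 ^ (n - k)) (2 ^ (n - k + 1)), cell ((1 / 2 : ℝ) ^ (n + 1)) j := by
  rintro x ⟨h1, h2⟩
  set ε := (1 / 2 : ℝ) ^ (n + 1) with hε
  have hεpos : 0 < ε := by positivity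
  obtain ⟨d, rfl⟩ := Nat.exists_eq_add_of_le hk
  have e1 : (1 / 2 : ℝ) ^ (k + 1) = 2 ^ d * ε := by
    rw [hε, show k + d + 1 = d + (k + 1) by ring, pow_add _ d, ← mul_assoc, ← mul_pow]
    norm_num
  have e2 : (1 / 2 : ℝ) ^ k = 2 ^ (d + 1) * ε := by
    rw [pow_succ 2 d, mul_right_comm, ← e1, pow_succ]; ring
  rw [e1] at h1
  rw [e2] at h2
  have hd : k + d - k = d := by omega
  rw [hd]
  have h3 : (2 : ℝ) ^ d < x / ε := by rwa [lt_div_iff₀ hεpos]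
  have h4 : x / ε ≤ (2 : ℝ) ^ (d + 1) := by rwa [div_le_iff₀ hεpos]
  have hceil1 : 2 ^ d < ⌈(x : ℝ) / ε⌉₊ := by
    rw [Nat.lt_ceil]; exact_mod_cast h3
  have hceil2 : ⌈(x : ℝ) / ε⌉₊ ≤ 2 ^ (d + 1) := by
    rw [Nat.ceil_le]; exact_mod_cast h4
  -- Cells are open on the left and closed on the right, so the index is the ceiling minus one, not
  -- the floor.
  obtain ⟨j, hj⟩ : ∃ j, ⌈(x : ℝ) / ε⌉₊ = j + 1 := Nat.exists_eq_succ_of_ne_zero (by omega)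
  simp only [mem_iUnion]
  refine ⟨j, Finset.mem_Ico.2 ⟨by omega, by omega⟩, ?_, ?_⟩
  · rw [← lt_div_iff₀ hεpos]
    exact Nat.lt_ceil.1 (by omega)
  · rw [← div_le_iff₀ hεpos]
    have := Nat.le_ceil ((x : ℝ) / ε)
    rw [hj] at this
    exact_mod_cast this

theorem cell_flux_le {n j k : ℕ} (hk : k ≤ n) (hj : j ∈ Finset.Ico (2 ^ (n - k)) (2 ^ (n - k + 1)))
    {x y : ℝ≥0} (hx : x ∈ cell ((1 / 2 : ℝ) ^ (n + 1)) j)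
    (hy : y ∈ cell ((1 / 2 : ℝ) ^ (n + 1)) j) :
    (1 / 4) * 2 ^ k ≤ Lam (bump (2 ^ n)) x y / √((x : ℝ) * y) := by
  obtain ⟨hx1, hx2⟩ := hx
  obtain ⟨hy1, hy2⟩ := hy
  set ε := (1 / 2 : ℝ) ^ (n + 1) with hε
  have hεpos : 0 < ε := by positivity
  have hnε : (2 : ℝ) ^ n * ε = 1 / 2 := by
    rw [hε, pow_succ, ← mul_assoc, ← mul_pow]; norm_num
  obtain ⟨hj1, hj2⟩ := Finset.mem_Ico.1 hj
  have hj1' : (1 : ℝ) ≤ j := by exact_mod_cast (Nat.one_le_two_pow).trans hj1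
  have hj2' : (j : ℝ) + 1 ≤ 2 ^ (n - k + 1) := by exact_mod_cast hj2
  have hlow : ε ≤ j * ε := by nlinarith
  have hupp : ((j : ℝ) + 1) * ε ≤ (1 / 2) ^ k := by
    calc ((j : ℝ) + 1) * ε ≤ 2 ^ (n - k + 1) * ε := by gcongr
      _ = (1 / 2) ^ k := by
        rw [hε, show n + 1 = (n - k + 1) + k by omega, pow_add _ (n - k + 1) k, ← mul_assoc,
          ← mul_pow]
        norm_num
  have hquart : 1 / 4 ≤ Lam (bump (2 ^ n)) x y := by
    have h2n : (0 : ℝ) < 2 ^ n := by positivity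
    refine quarter_le_Lam_bump ?_ ?_ ?_
    · rw [← hnε]; gcongr; linarith
    · rw [← hnε]; gcongr; linarith
    · rw [← hnε]; gcongr
      rw [abs_le]; constructor <;> linarith
  have hxpos : (0 : ℝ) < x := by linarith
  have hypos : (0 : ℝ) < y := by linarith
  have hsqrt : √((x : ℝ) * y) ≤ (1 / 2) ^ k := by
    rw [Real.sqrt_le_left (by positivity), sq]
    gcongr <;> linarith
  have hspos : 0 < √((x : ℝ) * y) := Real.sqrt_pos.2 (by positivity)
  rw [le_div_iff₀ hspos]
  calc (1 / 4) * 2 ^ k * √((x : ℝ) * y) ≤ (1 / 4) * 2 ^ k * (1 / 2) ^ k := by gcongr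
    _ = 1 / 4 := by rw [mul_assoc, ← mul_pow]; norm_num
    _ ≤ _ := hquart

/-- The shell k is covered by 2^(n-k) cells of width 2⁻ⁿ⁻¹, and only pairs in a common cell are
kept. There the integrand is at least 2^k / 4 (`cell_flux_le`), and Cauchy–Schwarz over the cells
costs a factor 2^(n-k). Cells of different shells are disjoint, so the contributions add. -/
theorem flux_le_Q32 (μ : FiniteMeasure ℝ≥0) (n : ℕ) :
    (1 / 4) * (1 / 2) ^ n *
      ∑ k ∈ Finset.range (n + 1), (2 ^ k * (μ : Measure ℝ≥0).real (shell k)) ^ 2 ≤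
      Q32 (bump (2 ^ n)) μ := by
  set ν : Measure ℝ≥0 := (μ : Measure ℝ≥0) with hν
  set ε := (1 / 2 : ℝ) ^ (n + 1) with hε
  have hεpos : 0 < ε := by positivity
  set S : ℕ → Finset ℕ := fun k => Finset.Ico (2 ^ (n - k)) (2 ^ (n - k + 1)) with hS
  set g : ℝ≥0 × ℝ≥0 → ℝ := fun p => Lam (bump (2 ^ n)) p.1 p.2 / √((p.1 : ℝ) * p.2) with hg
  have hgint : Integrable g (ν.prod ν) := integrable_Lam_bump μ (by positivity)
  have hg0 : ∀ p, 0 ≤ g p := fun p => div_nonneg (Lam_bump_nonneg _ _ _) (Real.sqrt_nonneg _)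
  have hSdisj : ((Finset.range (n + 1) : Finset ℕ) : Set ℕ).PairwiseDisjoint S := by
    intro k hk l hl hkl
    simp only [Finset.coe_range, mem_Iio] at hk hl
    have key : ∀ k l, k < l → l ≤ n → Disjoint (S k) (S l) := by
      intro k l hkl hl
      rw [Finset.disjoint_left]
      intro j h1 h2
      have h3 := (Finset.mem_Ico.1 h1).1
      have h4 := (Finset.mem_Ico.1 h2).2
      have h5 : 2 ^ (n - l + 1) ≤ 2 ^ (n - k) := Nat.pow_le_pow_right (by norm_num) (by omega)
      omega
    rcases lt_or_gt_of_ne hkl with h | h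
    · exact key k l h (by omega)
    · exact (key l k h (by omega)).symm
  set B := (Finset.range (n + 1)).biUnion S with hB
  have hmeas : ∀ j, MeasurableSet (cell ε j ×ˢ cell ε j) := fun j =>
    (measurableSet_cell ε j).prod (measurableSet_cell ε j)
  have hBpos : ∀ j ∈ B, 1 ≤ j := by
    intro j hj
    obtain ⟨k, -, hk⟩ := Finset.mem_biUnion.1 hj
    exact (Nat.one_le_two_pow).trans (Finset.mem_Ico.1 hk).1
  have hcells : ∑ j ∈ B, ∫ p in cell ε j ×ˢ cell ε j, g p ∂(ν.prod ν) ≤ Q32 (bump (2 ^ n)) μ := by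
    rw [← integral_biUnion_finset B (fun j _ => hmeas j) ?_ (fun j _ => hgint.integrableOn)]
    · refine setIntegral_mono_set hgint.integrableOn (Eventually.of_forall hg0)
        (LE.le.eventuallyLE ?_)
      intro p hp
      simp only [mem_iUnion] at hp
      obtain ⟨j, hj, h1, h2⟩ := hp
      have : (1 : ℝ) ≤ j := by exact_mod_cast hBpos j hj
      have h3 : 0 < j * ε := by positivity
      exact ⟨NNReal.coe_pos.1 (h3.trans h1.1), NNReal.coe_pos.1 (h3.trans h2.1)⟩
    · intro i _ j _ hij
      exact Set.Disjoint.set_prod_left (disjoint_cell hεpos hij) _ _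
  refine le_trans ?_ hcells
  rw [hB, Finset.sum_biUnion hSdisj, Finset.mul_sum]
  refine Finset.sum_le_sum fun k hk => ?_
  have hkn : k ≤ n := by have := Finset.mem_range.1 hk; omega
  have h1 : ν.real (shell k) ≤ ∑ j ∈ S k, ν.real (cell ε j) :=
    (measureReal_mono (shell_subset_cells hkn) (measure_ne_top _ _)).trans
      (measureReal_biUnion_finset_le _ _)
  have hcard : ((S k).card : ℝ) = 2 ^ (n - k) := by
    simp only [hS, Nat.card_Ico]
    rw [pow_succ, mul_two, Nat.add_sub_cancel]
    push_cast; rfl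
  have h2 : ν.real (shell k) ^ 2 ≤ 2 ^ (n - k) * ∑ j ∈ S k, ν.real (cell ε j) ^ 2 := by
    rw [← hcard]
    refine le_trans ?_ (sq_sum_le_card_mul_sum_sq (s := S k) (f := fun j => ν.real (cell ε j)))
    gcongr
  have h3 : ∀ j ∈ S k, (1 / 4) * 2 ^ k * ν.real (cell ε j) ^ 2 ≤
      ∫ p in cell ε j ×ˢ cell ε j, g p ∂(ν.prod ν) := by
    intro j hj
    have := setIntegral_ge_of_const_le_real (hmeas j) (measure_ne_top _ _)
      (fun p hp => cell_flux_le hkn hj hp.1 hp.2) (hgint.integrableOn (s := cell ε j ×ˢ cell ε j))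
    rw [measureReal_prod_prod] at this
    rwa [sq]
  calc (1 / 4) * (1 / 2) ^ n * (2 ^ k * ν.real (shell k)) ^ 2
      = (1 / 4) * (1 / 2) ^ n * 2 ^ k * 2 ^ k * ν.real (shell k) ^ 2 := by ring
    _ ≤ (1 / 4) * (1 / 2) ^ n * 2 ^ k * 2 ^ k *
        (2 ^ (n - k) * ∑ j ∈ S k, ν.real (cell ε j) ^ 2) := by gcongr
    _ = ∑ j ∈ S k, (1 / 4) * 2 ^ k * ν.real (cell ε j) ^ 2 := by
        rw [← Finset.mul_sum]
        have : (1 / 2 : ℝ) ^ n * (2 ^ k * 2 ^ (n - k)) = 1 := by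
          rw [← pow_add, Nat.add_sub_of_le hkn, ← mul_pow]; norm_num
        linear_combination ((1 / 4) * 2 ^ k * ∑ j ∈ S k, ν.real (cell ε j) ^ 2) * this
    _ ≤ _ := Finset.sum_le_sum h3

/-! ### The linear term as a source -/

theorem continuous_calL_bump {c : ℝ} (hc : 0 < c) : Continuous (calL (bump c)) := by
  have : calL (bump c) =
      fun x => x * bump c x - 2 * ((1 - (max (1 - c * x) 0) ^ 3) / (3 * c)) :=
    funext (calL_bump hc)
  have hcont := continuous_bump c
  rw [this]
  fun_prop

theorem integrable_calL_bump (μ : FiniteMeasure ℝ≥0) {c : ℝ} (hc : 0 < c) :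
    Integrable (fun x : ℝ≥0 => calL (bump c) x / √(x : ℝ)) (μ : Measure ℝ≥0) := by
  have hcont := continuous_calL_bump hc
  refine Integrable.of_bound (C := 1 + 2 / (3 * c)) ?_ (Eventually.of_forall fun x => ?_)
  · refine Measurable.aestronglyMeasurable (Measurable.div ?_ ?_)
    · exact Continuous.measurable (by fun_prop)
    · exact Continuous.measurable (by fun_prop)
  · rw [norm_div, Real.norm_eq_abs, Real.norm_eq_abs, abs_of_nonneg (Real.sqrt_nonneg _)]
    exact div_le_of_le_mul₀ (Real.sqrt_nonneg _) (by positivity) (abs_calL_bump_le hc x.2)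

theorem Q31tilde_bump_nonpos (μ : FiniteMeasure ℝ≥0) {c : ℝ} (hc : 0 < c) :
    Q31tilde (bump c) μ ≤ 0 :=
  integral_nonpos fun x =>
    div_nonpos_of_nonpos_of_nonneg (calL_bump_nonpos hc x.2) (Real.sqrt_nonneg _)

theorem source_le_neg_Q31tilde (μ : FiniteMeasure ℝ≥0) {c : ℝ} (hc : 0 < c) {χ : ℝ≥0 → ℝ}
    (hint : Integrable χ (μ : Measure ℝ≥0))
    (hχ : ∀ x : ℝ≥0, χ x ≤ 0 ∨ (1 ≤ c * x ∧ χ x * √(x : ℝ) ≤ 1)) :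
    2 / (3 * c) * ∫ x, χ x ∂(μ : Measure ℝ≥0) ≤ -Q31tilde (bump c) μ := by
  have h0 : ∀ x : ℝ≥0, 0 ≤ -(calL (bump c) x / √(x : ℝ)) := fun x => by
    rw [neg_nonneg]
    exact div_nonpos_of_nonpos_of_nonneg (calL_bump_nonpos hc x.2) (Real.sqrt_nonneg _)
  rw [Q31tilde, ← integral_neg, ← integral_const_mul, ← integral_indicator measurableSet_Ioi]
  refine integral_mono (hint.const_mul _)
    ((integrable_calL_bump μ hc).neg.indicator measurableSet_Ioi) fun x => ?_
  simp only
  have hc3 : 0 < 2 / (3 * c) := by positivity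
  rcases hχ x with h | ⟨h1, h2⟩
  · refine le_trans (mul_nonpos_of_nonneg_of_nonpos hc3.le h) (indicator_nonneg (fun y _ => h0 y) x)
  · have hx : (0 : ℝ) < x := by
      by_contra hcon
      have : c * (x : ℝ) ≤ 0 := mul_nonpos_of_nonneg_of_nonpos hc.le (by linarith)
      linarith
    rw [indicator_of_mem (show x ∈ Ioi (0 : ℝ≥0) from NNReal.coe_pos.1 hx), calL_bump_of_le hc h1,
      neg_div, neg_neg, le_div_iff₀ (Real.sqrt_pos.2 hx), mul_assoc]
    exact mul_le_of_le_one_right hc3.le h2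

/-! ### Smoothed masses, the atom and the shells -/

theorem integrable_bump (μ : FiniteMeasure ℝ≥0) {c : ℝ} (hc : 0 ≤ c) :
    Integrable (fun x : ℝ≥0 => bump c x) (μ : Measure ℝ≥0) := by
  have hcont := continuous_bump c
  refine Integrable.of_bound (C := 1) ?_ (Eventually.of_forall fun x => ?_)
  · exact (Continuous.measurable (by fun_prop)).aestronglyMeasurable
  · rw [Real.norm_eq_abs, abs_of_nonneg (bump_nonneg _ _)]
    exact bump_le_one hc x.2

/-- The integral of the test function over `(0, ∞)`. -/
theorem integral_bump_sub_atom (μ : FiniteMeasure ℝ≥0) {c : ℝ} (hc : 0 ≤ c) :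
    ∫ x : ℝ≥0, bump c x ∂(μ : Measure ℝ≥0) - (μ : Measure ℝ≥0).real {0} =
      ∫ x in Ioi (0 : ℝ≥0), bump c x ∂(μ : Measure ℝ≥0) := by
  rw [← integral_add_compl (measurableSet_singleton (0 : ℝ≥0)) (integrable_bump μ hc),
    integral_singleton]
  have : ({0}ᶜ : Set ℝ≥0) = Ioi 0 := by
    ext x; simp [pos_iff_ne_zero]
  rw [this]
  simp [bump_zero]

theorem integral_bump_sub_atom_le (μ : FiniteMeasure ℝ≥0) {c : ℝ} (hc : 0 ≤ c) :
    ∫ x : ℝ≥0, bump c x ∂(μ : Measure ℝ≥0) - (μ : Measure ℝ≥0).real {0} ≤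
      (μ : Measure ℝ≥0).real {x | 0 < x ∧ c * x < 1} := by
  have hm : MeasurableSet {x : ℝ≥0 | 0 < x ∧ c * x < 1} :=
    (measurableSet_lt measurable_const measurable_id).inter
      (measurableSet_lt (measurable_subtype_coe.const_mul c) measurable_const)
  rw [integral_bump_sub_atom μ hc, ← integral_indicator_one hm,
    ← integral_indicator measurableSet_Ioi]
  refine integral_mono ((integrable_bump μ hc).indicator measurableSet_Ioi)
    ((integrable_const (1 : ℝ)).indicator hm) fun x => ?_
  by_cases hx : x ∈ Ioi (0 : ℝ≥0)
  · rw [indicator_of_mem hx]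
    rcases lt_or_ge (c * x) 1 with h | h
    · rw [indicator_of_mem (show x ∈ {x : ℝ≥0 | 0 < x ∧ c * x < 1} from ⟨hx, h⟩)]
      exact bump_le_one hc x.2
    · rw [bump_eq_zero h]
      exact indicator_nonneg (fun _ _ => zero_le_one) x
  · rw [indicator_of_notMem hx]
    exact indicator_nonneg (fun _ _ => zero_le_one) x

theorem measureReal_le_integral_bump_sub_atom (μ : FiniteMeasure ℝ≥0) {c : ℝ} (hc : 0 ≤ c) :
    (μ : Measure ℝ≥0).real {x | 0 < x ∧ c * x ≤ 1 / 2} ≤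
      4 * (∫ x : ℝ≥0, bump c x ∂(μ : Measure ℝ≥0) - (μ : Measure ℝ≥0).real {0}) := by
  have hm : MeasurableSet {x : ℝ≥0 | 0 < x ∧ c * x ≤ 1 / 2} :=
    (measurableSet_lt measurable_const measurable_id).inter
      (measurableSet_le (measurable_subtype_coe.const_mul c) measurable_const)
  have h1 := setIntegral_ge_of_const_le_real (μ := (μ : Measure ℝ≥0)) (c := 1 / 4) hm
    (measure_ne_top _ _) (f := fun x : ℝ≥0 => bump c x) (fun x hx => ?_)
    (integrable_bump μ hc).integrableOn
  · have h2 : ∫ x in {x : ℝ≥0 | 0 < x ∧ c * x ≤ 1 / 2}, bump c x ∂(μ : Measure ℝ≥0) ≤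
        ∫ x in Ioi (0 : ℝ≥0), bump c x ∂(μ : Measure ℝ≥0) :=
      setIntegral_mono_set (integrable_bump μ hc).integrableOn
        (Eventually.of_forall fun x => bump_nonneg _ _)
        (LE.le.eventuallyLE fun x hx => hx.1)
    rw [integral_bump_sub_atom μ hc]
    linarith
  · have : c * (x : ℝ) ≤ 1 / 2 := hx.2
    rw [bump, max_eq_left (by linarith)]
    nlinarith

theorem integral_bump_sub_atom_nonneg (μ : FiniteMeasure ℝ≥0) {c : ℝ} (hc : 0 ≤ c) :
    0 ≤ ∫ x : ℝ≥0, bump c x ∂(μ : Measure ℝ≥0) - (μ : Measure ℝ≥0).real {0} := by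
  rw [integral_bump_sub_atom μ hc]
  exact integral_nonneg fun _ => bump_nonneg _ _

/-- The interval (0, 2⁻ⁿ) is covered by the shells n, ..., N and the remainder (0, 2⁻ᴺ⁻¹], on which
`bump (2 ^ N)` is at least 1/4; hence the factor 4. -/
theorem integral_bump_sub_atom_le_sum_shell (μ : FiniteMeasure ℝ≥0) {n N : ℕ} (hnN : n ≤ N) :
    ∫ x : ℝ≥0, bump (2 ^ n) x ∂(μ : Measure ℝ≥0) - (μ : Measure ℝ≥0).real {0} ≤
      ∑ k ∈ Finset.Icc n N, (μ : Measure ℝ≥0).real (shell k) +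
        4 * (∫ x : ℝ≥0, bump (2 ^ N) x ∂(μ : Measure ℝ≥0) - (μ : Measure ℝ≥0).real {0}) := by
  have hsub : {x : ℝ≥0 | 0 < x ∧ (2 : ℝ) ^ n * x < 1} ⊆
      (⋃ k ∈ Finset.Icc n N, shell k) ∪ {x : ℝ≥0 | 0 < x ∧ (2 : ℝ) ^ N * x ≤ 1 / 2} := by
    clear μ
    induction N, hnN using Nat.le_induction with
    | base =>
      rintro x ⟨h1, h2⟩
      rcases le_or_gt ((2 : ℝ) ^ n * x) (1 / 2) with h | h
      · exact Or.inr ⟨h1, h⟩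
      · refine Or.inl ?_
        simp only [Finset.Icc_self, Finset.mem_singleton, iUnion_iUnion_eq_left]
        have e : (2 : ℝ) ^ n * (1 / 2) ^ n = 1 := by rw [← mul_pow]; norm_num
        have hp : (0 : ℝ) < 2 ^ n := by positivity
        constructor
        · refine lt_of_mul_lt_mul_left ?_ hp.le
          rw [pow_succ, ← mul_assoc, e]; linarith
        · refine le_of_mul_le_mul_left ?_ hp
          rw [e]; exact h2.le
    | succ N hN ih =>
      intro x hx
      rcases ih hx with h | ⟨h1, h2⟩
      · refine Or.inl (biUnion_subset_biUnion_left ?_ h)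
        intro k hk
        simp only [Finset.mem_coe, Finset.mem_Icc] at hk ⊢
        exact ⟨hk.1, by omega⟩
      · rcases le_or_gt ((2 : ℝ) ^ (N + 1) * x) (1 / 2) with h | h
        · exact Or.inr ⟨h1, h⟩
        · refine Or.inl ?_
          simp only [mem_iUnion]
          refine ⟨N + 1, Finset.mem_Icc.2 ⟨by omega, le_rfl⟩, ?_, ?_⟩
          · have e : (2 : ℝ) ^ (N + 1) * (1 / 2) ^ (N + 1) = 1 := by rw [← mul_pow]; norm_num
            refine lt_of_mul_lt_mul_left ?_ (show (0 : ℝ) ≤ 2 ^ (N + 1) by positivity)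
            rw [pow_succ (1 / 2 : ℝ), ← mul_assoc, e]; linarith
          · have e : (2 : ℝ) ^ N * (1 / 2) ^ N = 1 := by rw [← mul_pow]; norm_num
            refine le_of_mul_le_mul_left ?_ (show (0 : ℝ) < 2 ^ N by positivity)
            rw [pow_succ, ← mul_assoc, e]; linarith
  refine (integral_bump_sub_atom_le μ (by positivity)).trans
    ((measureReal_mono hsub (measure_ne_top _ _)).trans ((measureReal_union_le _ _).trans ?_))
  exact add_le_add (measureReal_biUnion_finset_le _ _)
    (measureReal_le_integral_bump_sub_atom μ (by positivity))

theorem tendsto_integral_bump (μ : FiniteMeasure ℝ≥0) :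
    Tendsto (fun n : ℕ => ∫ x : ℝ≥0, bump (2 ^ n) x ∂(μ : Measure ℝ≥0)) atTop
      (𝓝 ((μ : Measure ℝ≥0).real {0})) := by
  rw [← integral_indicator_one (measurableSet_singleton (0 : ℝ≥0))]
  refine tendsto_integral_of_dominated_convergence (fun _ => 1)
    (fun n => (integrable_bump μ (by positivity)).aestronglyMeasurable) (integrable_const 1)
    (fun n => Eventually.of_forall fun x => ?_) (Eventually.of_forall fun x => ?_)
  · rw [Real.norm_eq_abs, abs_of_nonneg (bump_nonneg _ _)]
    exact bump_le_one (by positivity) x.2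
  · rcases eq_or_ne x 0 with rfl | hx
    · simp [bump_zero]
    · rw [indicator_of_notMem (by simpa using hx)]
      have hxpos : (0 : ℝ) < x := NNReal.coe_pos.2 (pos_iff_ne_zero.2 hx)
      have h1 : Tendsto (fun n : ℕ => (2 : ℝ) ^ n * x) atTop atTop :=
        (tendsto_pow_atTop_atTop_of_one_lt one_lt_two).atTop_mul_const hxpos
      refine tendsto_const_nhds.congr' ?_
      filter_upwards [h1.eventually_ge_atTop 1] with n hn
      exact (bump_eq_zero hn).symm

/-! ### Mass away from the origin -/

/-- The concave observable `∫ (1 - (1 - x)₊²) dμ` is destroyed at most at a linear rate. -/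
theorem neg_le_Q3tilde_one_sub_bump (μ : FiniteMeasure ℝ≥0) :
    -(4 * (μ : Measure ℝ≥0).real univ * ∫ x : ℝ≥0, (1 - bump 1 x) ∂(μ : Measure ℝ≥0)) ≤
      Q3tilde (fun x => 1 - bump 1 x) μ := by
  have hL : Q31tilde (fun x => 1 - bump 1 x) μ ≤ 0 := integral_nonpos fun x =>
    div_nonpos_of_nonpos_of_nonneg (calL_one_sub_bump_nonpos x.2) (Real.sqrt_nonneg _)
  have hΛ : Q32 (fun x => 1 - bump 1 x) μ = -Q32 (bump 1) μ := by
    rw [Q32, Q32, ← integral_neg]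
    refine integral_congr_ae (Eventually.of_forall fun p => ?_)
    simp only [Lam]
    ring
  have hφ : Integrable (fun x : ℝ≥0 => 1 - bump 1 x) (μ : Measure ℝ≥0) :=
    (integrable_const 1).sub (integrable_bump μ zero_le_one)
  have h0 : ∀ x : ℝ≥0, 0 ≤ 1 - bump 1 x := fun x =>
    sub_nonneg.2 (bump_le_one zero_le_one x.coe_nonneg)
  have hi1 : Integrable (fun p : ℝ≥0 × ℝ≥0 => 1 - bump 1 p.1)
      ((μ : Measure ℝ≥0).prod (μ : Measure ℝ≥0)) := hφ.comp_fst _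
  have hi2 : Integrable (fun p : ℝ≥0 × ℝ≥0 => 1 - bump 1 p.2)
      ((μ : Measure ℝ≥0).prod (μ : Measure ℝ≥0)) := hφ.comp_snd _
  have hQ : Q32 (bump 1) μ ≤
      4 * (μ : Measure ℝ≥0).real univ * ∫ x : ℝ≥0, (1 - bump 1 x) ∂(μ : Measure ℝ≥0) := by
    calc Q32 (bump 1) μ ≤ ∫ p : ℝ≥0 × ℝ≥0, Lam (bump 1) p.1 p.2 / √((p.1 : ℝ) * p.2)
            ∂((μ : Measure ℝ≥0).prod (μ : Measure ℝ≥0)) :=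
          setIntegral_le_integral (integrable_Lam_bump μ zero_le_one)
            (Eventually.of_forall fun p => div_nonneg (Lam_bump_nonneg _ _ _) (Real.sqrt_nonneg _))
      _ ≤ ∫ p : ℝ≥0 × ℝ≥0, 2 * ((1 - bump 1 p.1) + (1 - bump 1 p.2))
            ∂((μ : Measure ℝ≥0).prod (μ : Measure ℝ≥0)) := by
          refine integral_mono (integrable_Lam_bump μ zero_le_one) ((hi1.add hi2).const_mul 2)
            fun p => ?_
          exact div_le_of_le_mul₀ (Real.sqrt_nonneg _)
            (mul_nonneg zero_le_two (add_nonneg (h0 _) (h0 _))) (Lam_bump_one_le p.1.2 p.2.2)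
      _ = _ := by
          rw [integral_const_mul, integral_add hi1 hi2,
            integral_fun_fst (fun x : ℝ≥0 => 1 - bump 1 x),
            integral_fun_snd (fun x : ℝ≥0 => 1 - bump 1 x)]
          simp only [smul_eq_mul]
          ring
  rw [Q3tilde, hΛ]
  linarith

theorem integral_one_sub_bump_pos_iff (μ : FiniteMeasure ℝ≥0) :
    0 < ∫ x : ℝ≥0, (1 - bump 1 x) ∂(μ : Measure ℝ≥0) ↔ 0 < (μ : Measure ℝ≥0) (Ioi 0) := by
  have h0 : ∀ x : ℝ≥0, 0 ≤ 1 - bump 1 x := fun x =>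
    sub_nonneg.2 (bump_le_one zero_le_one x.coe_nonneg)
  have hsupp : Function.support (fun x : ℝ≥0 => 1 - bump 1 x) = Ioi 0 := by
    ext x
    simp only [Function.mem_support, mem_Ioi]
    constructor
    · intro hx
      rw [pos_iff_ne_zero]
      rintro rfl
      exact hx (by simp [bump_zero])
    · intro hx
      have hx' : (0 : ℝ) < x := NNReal.coe_pos.2 hx
      have : bump 1 x < 1 :=
        pow_lt_one₀ (le_max_right _ _) (max_lt (by linarith) one_pos) two_ne_zero
      linarith
  rw [integral_pos_iff_support_of_nonneg h0
    ((integrable_const 1).sub (integrable_bump μ zero_le_one)), hsupp]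

theorem measure_Ioi_pos_of_moment_pos {μ : FiniteMeasure ℝ≥0} (hμ : 0 < moment 1 μ) :
    0 < (μ : Measure ℝ≥0) (Ioi 0) := by
  rw [pos_iff_ne_zero]
  intro hzero
  refine hμ.ne' ?_
  rw [moment, lintegral_eq_zero_iff (by fun_prop)]
  have : ∀ᵐ x ∂(μ : Measure ℝ≥0), x ∉ Ioi (0 : ℝ≥0) := measure_eq_zero_iff_ae_notMem.1 hzero
  filter_upwards [this] with x hx
  have : x = 0 := by simpa using hx
  simp [this]

/-- A continuous bounded minorant of 1/√x is needed, rather than an indicator, so that narrow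
continuity keeps its integral positive for a short time. -/
theorem exists_source {μ : FiniteMeasure ℝ≥0} (hμ : 0 < (μ : Measure ℝ≥0) (Ioi 0)) :
    ∃ (χ : BoundedContinuousFunction ℝ≥0 ℝ) (m : ℕ), 0 < ∫ x, χ x ∂(μ : Measure ℝ≥0) ∧
      ∀ n, m ≤ n → ∀ x : ℝ≥0, χ x ≤ 0 ∨ (1 ≤ (2 : ℝ) ^ n * x ∧ χ x * √(x : ℝ) ≤ 1) := by
  set A : ℕ → Set ℝ≥0 := fun j => {x | 1 / ((j : ℝ) + 1) < x ∧ (x : ℝ) < j + 1} with hA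
  have hcover : Ioi (0 : ℝ≥0) ⊆ ⋃ j, A j := by
    intro x hx
    have hx' : (0 : ℝ) < x := NNReal.coe_pos.2 hx
    obtain ⟨i, hi⟩ := exists_nat_one_div_lt hx'
    obtain ⟨k, hk⟩ := exists_nat_gt (x : ℝ)
    refine mem_iUnion.2 ⟨max i k, lt_of_le_of_lt ?_ hi, hk.trans_le ?_⟩
    · have : (i : ℝ) ≤ (max i k : ℕ) := by exact_mod_cast le_max_left i k
      gcongr
    · have : (k : ℝ) ≤ (max i k : ℕ) := by exact_mod_cast le_max_right i k
      linarith
  obtain ⟨j, hj⟩ := exists_measure_pos_of_not_measure_iUnion_null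
    (fun h0 => (hμ.trans_le (measure_mono hcover)).ne' h0)
  set β : ℝ := (j : ℝ) + 1 with hβ
  have hβ1 : 1 ≤ β := by rw [hβ]; linarith [Nat.cast_nonneg (α := ℝ) j]
  have hβ0 : 0 < β := by linarith
  -- A tent on (1/β, β) of height at most β. Division by β² gives ψ ≤ 1/β, while √x ≤ β on the
  -- support, so ψ √x ≤ 1.
  set ψ : ℝ≥0 → ℝ := fun x => min (max ((x : ℝ) - 1 / β) 0) (max (β - x) 0) / β ^ 2 with hψ
  have hψcont : Continuous ψ := by simp only [hψ]; fun_prop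
  have hψ0 : ∀ x, 0 ≤ ψ x := fun x =>
    div_nonneg (le_min (le_max_right _ _) (le_max_right _ _)) (by positivity)
  have hψle : ∀ x, ψ x ≤ 1 / β := fun x => by
    rw [hψ, div_le_div_iff₀ (by positivity) hβ0]
    have h1 : min (max ((x : ℝ) - 1 / β) 0) (max (β - x) 0) ≤ β :=
      (min_le_right _ _).trans (max_le (by linarith [x.coe_nonneg]) hβ0.le)
    nlinarith
  have hψA : ∀ x, x ∈ A j ↔ 0 < ψ x := fun x => by
    rw [hψ, lt_div_iff₀ (by positivity), zero_mul, lt_min_iff, lt_max_iff, lt_max_iff]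
    simp only [hA, mem_ofPred_eq, lt_irrefl, or_false, sub_pos, hβ]
  refine ⟨BoundedContinuousFunction.ofNormedAddCommGroup ψ hψcont (1 / β) fun x => ?_, j, ?_, ?_⟩
  · rw [Real.norm_eq_abs, abs_of_nonneg (hψ0 x)]; exact hψle x
  · simp only [BoundedContinuousFunction.coe_ofNormedAddCommGroup]
    have hint : Integrable ψ (μ : Measure ℝ≥0) :=
      Integrable.of_bound hψcont.aestronglyMeasurable (1 / β) (Eventually.of_forall fun x => by
        rw [Real.norm_eq_abs, abs_of_nonneg (hψ0 x)]; exact hψle x)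
    rw [integral_pos_iff_support_of_nonneg hψ0 hint]
    exact hj.trans_le (measure_mono fun x hx => ((hψA x).1 hx).ne')
  · intro n hn x
    simp only [BoundedContinuousFunction.coe_ofNormedAddCommGroup]
    rcases (hψ0 x).eq_or_lt with h | h
    · exact Or.inl h.symm.le
    · obtain ⟨h1, h2⟩ := (hψA x).2 h
      refine Or.inr ⟨?_, ?_⟩
      · have h3 : β ≤ (2 : ℝ) ^ n := by
          have h4 : j + 1 ≤ 2 ^ n :=
            (Nat.lt_two_pow_self (n := j)).trans_le (Nat.pow_le_pow_right (by norm_num) hn)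
          rw [hβ]; exact_mod_cast h4
        calc (1 : ℝ) = β * (1 / β) := by field_simp
          _ ≤ 2 ^ n * x := by gcongr
      · have h3 : √(x : ℝ) ≤ β := by
          rw [Real.sqrt_le_left hβ0.le]
          have : (x : ℝ) < β := h2
          nlinarith
        calc ψ x * √(x : ℝ) ≤ 1 / β * β := by
              have := hψle x
              gcongr
          _ = 1 := by field_simp

/-! ### Weak solutions: monotonicity, right continuity and strictness -/

variable {h : ℝ → FiniteMeasure ℝ≥0}

theorem IsWeakSolution.absolutelyContinuous (hsol : IsWeakSolution h) {φ : ℝ → ℝ} (hφ : IsC1b φ)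
    {s t : ℝ} (hs : 0 ≤ s) (hst : s ≤ t) :
    AbsolutelyContinuousOnInterval
      (fun τ => ∫ x : ℝ≥0, φ (x : ℝ) ∂(h τ : Measure ℝ≥0)) s t := by
  refine ((hsol φ hφ).1 (t + 1) (by linarith)).mono ?_
  rw [uIcc_of_le hst, uIcc_of_le (by linarith)]
  exact Icc_subset_Icc hs (by linarith)

theorem IsWeakSolution.hasDerivAt (hsol : IsWeakSolution h) {φ : ℝ → ℝ} (hφ : IsC1b φ) :
    ∀ᵐ τ, 0 < τ → HasDerivAt (fun s => ∫ x : ℝ≥0, φ (x : ℝ) ∂(h s : Measure ℝ≥0))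
      (Q3tilde φ (h τ)) τ :=
  (ae_restrict_iff' measurableSet_Ioi).1 (hsol φ hφ).2

theorem Q3tilde_bump_nonneg (μ : FiniteMeasure ℝ≥0) {c : ℝ} (hc : 0 < c) :
    0 ≤ Q3tilde (bump c) μ := by
  have h1 := Q32_bump_nonneg μ c
  have h2 := Q31tilde_bump_nonpos μ hc
  rw [Q3tilde]
  linarith

theorem IsWeakSolution.integral_bump_mono (hsol : IsWeakSolution h) {c : ℝ} (hc : 0 < c)
    {s t : ℝ} (hs : 0 ≤ s) (hst : s ≤ t) :
    ∫ x : ℝ≥0, bump c x ∂(h s : Measure ℝ≥0) ≤ ∫ x : ℝ≥0, bump c x ∂(h t : Measure ℝ≥0) := by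
  have hφ := isC1b_bump hc.le
  have := le_sub_of_absolutelyContinuous (c := 0) hst (hsol.absolutelyContinuous hφ hs hst) (by
    filter_upwards [hsol.hasDerivAt hφ] with u hu hmem
    exact ⟨_, hu (hs.trans_lt hmem.1), Q3tilde_bump_nonneg _ hc⟩)
  linarith

theorem IsWeakSolution.atomAtZero_mono (hsol : IsWeakSolution h) :
    MonotoneOn (atomAtZero h) (Ici 0) := fun _ hs _ _ hst =>
  le_of_tendsto_of_tendsto' (tendsto_integral_bump (h _)) (tendsto_integral_bump (h _))
    fun _ => hsol.integral_bump_mono (by positivity) hs hst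

/-- Monotonicity bounds the atom from below to the right of τ; from above it is bounded by a
smoothed mass that is continuous in time and close to the atom at τ. -/
theorem IsWeakSolution.continuousWithinAt_atomAtZero (hsol : IsWeakSolution h) {τ : ℝ}
    (hτ : 0 ≤ τ) : ContinuousWithinAt (atomAtZero h) (Ici τ) τ := by
  have hle : ∀ (n : ℕ) s, atomAtZero h s ≤ ∫ x : ℝ≥0, bump (2 ^ n) x ∂(h s : Measure ℝ≥0) :=
    fun n s => sub_nonneg.1 (integral_bump_sub_atom_nonneg (h s) (by positivity))
  refine tendsto_order.2 ⟨fun y hy => ?_, fun y hy => ?_⟩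
  · filter_upwards [self_mem_nhdsWithin] with s hs
    exact hy.trans_le (hsol.atomAtZero_mono hτ (hτ.trans hs) hs)
  · obtain ⟨n, hn⟩ := ((tendsto_integral_bump (h τ)).eventually_lt_const hy).exists
    have hcont := (hsol.absolutelyContinuous (isC1b_bump (by positivity : (0 : ℝ) ≤ 2 ^ n)) hτ
      (by linarith : τ ≤ τ + 1)).continuousOn
    rw [uIcc_of_le (by linarith)] at hcont
    have h1 : ContinuousWithinAt (fun s => ∫ x : ℝ≥0, bump (2 ^ n) x ∂(h s : Measure ℝ≥0))
        (Ici τ) τ :=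
      (hcont τ ⟨le_rfl, by linarith⟩).mono_of_mem_nhdsWithin (Icc_mem_nhdsGE (by linarith))
    filter_upwards [h1.eventually_lt_const hn] with s hs
    exact (hle n s).trans_lt hs

theorem IsWeakSolution.ae_differentiableAt_atomAtZero (hsol : IsWeakSolution h) :
    ∀ᵐ τ ∂(volume.restrict (Ici (0 : ℝ))), DifferentiableAt ℝ (atomAtZero h) τ := by
  rw [← restrict_Ioi_eq_restrict_Ici, ae_restrict_iff' measurableSet_Ioi]
  filter_upwards [hsol.atomAtZero_mono.ae_differentiableWithinAt_of_mem] with τ hτ hpos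
  exact (hτ (Ioi_subset_Ici_self hpos)).differentiableAt (Ici_mem_nhds hpos)

/-- Part of the mass stays away from the origin at all times. -/
theorem IsWeakSolution.measure_Ioi_pos (hsol : IsWeakSolution h) (hcont : ContinuousOn h (Ici 0))
    (h0 : 0 < (h 0 : Measure ℝ≥0) (Ioi 0)) {τ : ℝ} (hτ : 0 ≤ τ) :
    0 < (h τ : Measure ℝ≥0) (Ioi 0) := by
  rw [← integral_one_sub_bump_pos_iff] at h0 ⊢
  have hφ := isC1b_one_sub_bump zero_le_one
  set u : ℝ → ℝ := fun s => ∫ x : ℝ≥0, (1 - bump 1 x) ∂(h s : Measure ℝ≥0) with hu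
  have hunn : ∀ s, 0 ≤ u s := fun s => integral_nonneg fun x =>
    sub_nonneg.2 (bump_le_one zero_le_one x.coe_nonneg)
  -- The total mass is narrowly continuous, hence bounded on a compact time interval.
  obtain ⟨M, hM⟩ : ∃ M : ℝ, ∀ s ∈ Icc 0 τ, (h s : Measure ℝ≥0).real univ ≤ M := by
    have h1 : ContinuousOn (fun s => ((h s).mass : ℝ)) (Icc 0 τ) :=
      (NNReal.continuous_coe.comp FiniteMeasure.continuous_mass).comp_continuousOn
        (hcont.mono Icc_subset_Ici_self)
    obtain ⟨M, hM⟩ := isCompact_Icc.exists_bound_of_continuousOn h1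
    exact ⟨M, fun s hs => (le_abs_self _).trans (hM s hs)⟩
  set K := 4 * M with hK
  have hexp : AbsolutelyContinuousOnInterval (fun s => Real.exp (K * s)) 0 τ :=
    (show ContDiff ℝ 1 fun s : ℝ => Real.exp (K * s) by fun_prop).contDiffOn
      |>.absolutelyContinuousOnInterval
  -- Grönwall with an integrating factor: u' ≥ -K u a.e., so exp(K s) u(s) is nondecreasing.
  have hgrow := le_sub_of_absolutelyContinuous (c := 0) hτ
    (hexp.mul (hsol.absolutelyContinuous hφ le_rfl hτ)) (by
      filter_upwards [hsol.hasDerivAt hφ] with s hs hmem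
      have h1 : HasDerivAt (fun s => Real.exp (K * s)) (Real.exp (K * s) * K) s := by
        simpa using ((hasDerivAt_id s).const_mul K).exp
      refine ⟨_, h1.mul (hs hmem.1), ?_⟩
      have h2 := neg_le_Q3tilde_one_sub_bump (h s)
      have h3 : 4 * (h s : Measure ℝ≥0).real univ * u s ≤ K * u s := by
        have := hM s ⟨hmem.1.le, hmem.2.le⟩
        have := hunn s
        rw [hK]; gcongr
      have h4 : 0 ≤ K * u s + Q3tilde (fun x => 1 - bump 1 x) (h s) := by linarith
      have h5 := mul_nonneg (Real.exp_pos (K * s)).le h4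
      calc (0 : ℝ) ≤ _ := h5
        _ = Real.exp (K * s) * K * u s +
            Real.exp (K * s) * Q3tilde (fun x => 1 - bump 1 x) (h s) := by ring)
  have hgrow' : u 0 ≤ Real.exp (K * τ) * u τ := by simpa using hgrow
  exact pos_of_mul_pos_right (h0.trans_le hgrow') (Real.exp_pos _).le

/-- Constancy of the atom lets it be subtracted without changing the time derivative, while the
differences still tend to 0 at b. -/
theorem IsWeakSolution.dyadicCascade (hsol : IsWeakSolution h) {a b : ℝ} (ha : 0 ≤ a) (hab : a < b)
    (hconst : ∀ t ∈ Icc a b, atomAtZero h t = atomAtZero h a) :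
    DyadicCascade a b
      (fun n t => ∫ x : ℝ≥0, bump (2 ^ n) x ∂(h t : Measure ℝ≥0) - atomAtZero h a)
      (fun k t => (h t : Measure ℝ≥0).real (shell k)) (fun n t => Q3tilde (bump (2 ^ n)) (h t)) where
  nonneg n t ht := by
    rw [← hconst t ht]
    exact integral_bump_sub_atom_nonneg (h t) (by positivity)
  mass_nonneg n t := measureReal_nonneg
  antitone t ht n N hnN := by
    refine sub_le_sub_right (integral_mono (integrable_bump _ (by positivity))
      (integrable_bump _ (by positivity)) fun x => ?_) _
    exact bump_anti_scale (pow_le_pow_right₀ one_le_two hnN) x.coe_nonneg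
  tendsto := by
    rw [← hconst b ⟨hab.le, le_rfl⟩, ← sub_self (atomAtZero h b)]
    exact (tendsto_integral_bump (h b)).sub_const _
  le_sum t ht n N hnN := by
    rw [← hconst t ht]
    exact integral_bump_sub_atom_le_sum_shell (h t) hnN
  ac n := (hsol.absolutelyContinuous (isC1b_bump (by positivity)) ha hab.le).sub
    (LipschitzWith.const (atomAtZero h a)).lipschitzOnWith.absolutelyContinuousOnInterval
  hasDeriv n := by
    filter_upwards [hsol.hasDerivAt (isC1b_bump (by positivity : (0 : ℝ) ≤ 2 ^ n))] with u hu hmem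
    exact (hu (ha.trans_lt hmem.1)).sub_const _
  flux n u _ := by
    have h1 := flux_le_Q32 (h u) n
    have h2 := Q31tilde_bump_nonpos (h u) (c := 2 ^ n) (by positivity)
    rw [Q3tilde]
    linarith

theorem IsWeakSolution.strictMonoOn_atomAtZero (hsol : IsWeakSolution h)
    (hcont : ContinuousOn h (Ici 0)) (h0 : 0 < (h 0 : Measure ℝ≥0) (Ioi 0)) :
    StrictMonoOn (atomAtZero h) (Ici 0) := by
  intro a ha t ht hat
  have ha' : (0 : ℝ) ≤ a := ha
  refine lt_of_le_of_ne (hsol.atomAtZero_mono ha ht hat.le) fun heq => ?_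
  obtain ⟨χ, m, hχpos, hχ⟩ := exists_source (hsol.measure_Ioi_pos hcont h0 ha')
  set I : ℝ → ℝ := fun s => ∫ x, χ x ∂(h s : Measure ℝ≥0) with hI
  have hIcont : Tendsto I (𝓝[≥] a) (𝓝 (I a)) :=
    FiniteMeasure.tendsto_iff_forall_integral_tendsto.1
      ((hcont a ha).mono (Ici_subset_Ici.2 ha')) χ
  have hev : ∀ᶠ s in 𝓝[≥] a, I a / 2 < I s :=
    hIcont.eventually_const_lt (half_lt_self hχpos)
  obtain ⟨d, had, hd⟩ := (mem_nhdsGE_iff_exists_Ico_subset).1 hev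
  have had' : a < d := had
  -- Before d the source keeps half its initial strength; up to t the atom is constant by
  -- monotonicity.
  set b := min d t with hb
  have hab : a < b := lt_min had' hat
  have hconst : ∀ s ∈ Icc a b, atomAtZero h s = atomAtZero h a := by
    intro s hs
    have hs0 : s ∈ Ici (0 : ℝ) := ha'.trans hs.1
    refine le_antisymm ?_ (hsol.atomAtZero_mono ha hs0 hs.1)
    rw [heq]
    exact hsol.atomAtZero_mono hs0 ht (hs.2.trans (min_le_right _ _))
  refine (hsol.dyadicCascade ha' hab hconst).false_of_source hab
    (c₀ := 2 / 3 * (I a / 2)) (mul_pos (by norm_num) (half_pos hχpos)) m fun n hn u hu => ?_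
  have h1 := source_le_neg_Q31tilde (h u) (c := 2 ^ n) (by positivity)
    (χ.integrable (h u : Measure ℝ≥0)) (hχ n hn)
  have h2 : I a / 2 < I u := hd ⟨hu.1.le, hu.2.trans_le (min_le_left _ _)⟩
  have h3 := Q32_bump_nonneg (h u) (2 ^ n)
  rw [Q3tilde]
  calc 2 / 3 * (I a / 2) * (1 / 2) ^ n = 2 / (3 * 2 ^ n) * (I a / 2) := by
        rw [div_pow, one_pow]; field_simp
    _ ≤ 2 / (3 * 2 ^ n) * I u := by gcongr
    _ ≤ _ := by linarith

end BoseCondensate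

theorem theorem4p1 (h : ℝ → FiniteMeasure ℝ≥0) (h₀ : FiniteMeasure ℝ≥0)
    (hcurve : BoseCondensate.IsNarrowCurve h)
    (hsol : BoseCondensate.IsWeakSolution h)
    (hinit : h 0 = h₀)
    (hN : 0 < BoseCondensate.moment 0 h₀)
    (hE : 0 < BoseCondensate.moment 1 h₀) :
    (∀ τ ∈ Ici (0 : ℝ), ContinuousWithinAt (BoseCondensate.atomAtZero h) (Ici τ) τ) ∧
    (∀ᵐ τ ∂(volume.restrict (Ici (0 : ℝ))),
      DifferentiableAt ℝ (BoseCondensate.atomAtZero h) τ) ∧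
    StrictMonoOn (BoseCondensate.atomAtZero h) (Ici (0 : ℝ)) := by
  refine ⟨fun τ hτ => hsol.continuousWithinAt_atomAtZero hτ, hsol.ae_differentiableAt_atomAtZero,
    hsol.strictMonoOn_atomAtZero hcurve.1 ?_⟩
  rw [hinit]
  exact BoseCondensate.measure_Ioi_pos_of_moment_pos hE
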